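/- **Setting.** Let $Q$ be a smooth manifold of finite dimension $n$ with Riemannian metric $g$, let $L(q,\dot q)=\tfrac12 g_q(\dot q,\dot q)-V(q)$ be a natural Lagrangian with smooth potential $V$, $\mathbb FL(v)=g(v,\cdot)$ its fiber derivative and $H:T^*Q\to\mathbb R$, $H(q,p)=p(\dot q)-L(q,\dot q)$ with $p=\mathbb FL(\dot q)$, the Hamiltonian. Let $\pi_Q:T^*Q\to Q$ be the projection, $\omega=dq^i\wedge dp_i$ the canonical symplectic form, $\{f,k\}=\omega(X_f,X_k)$ with $i_{X_f}\omega=df$, and $P(W)(q,p)=\langle p,W(q)\rangle$ for a vector field $W$ on $Q$. Let $\mathscr C=\{\eta^1,\dots,\eta^m\}$ be smooth, pointwise linearly independent 1-forms on $Q$, $\mathcal D=\bigcap_\alpha\ker\eta^\alpha$, $\mathcal D^*=\mathbb FL(\mathcal D)$, $W^\alpha=\mathbb FL^{-1}\eta^\alpha$, $m^{\alpha\beta}=g(W^\alpha,W^\beta)$, $(m_{\alpha\beta})=(m^{\alpha\beta})^{-1}$, and let $\pi_{\mathcal D}v=v-m_{\alpha\beta}\eta^\alpha(v)W^\beta$ be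 the $g$-orthogonal projection $TQ\to\mathcal D$; write $\pi_{\mathcal D}^*dh=dh\circ\pi_{\mathcal D}$. Let $h:Q\to\mathbb R$ be smooth such that at every point of $S=h^{-1}(0)$ the form $dh$ does not vanish on $\mathcal D$. Put $\nabla h=\mathbb FL^{-1}dh$, $S^*=\{(q,p): h(q)=0,\ P(\nabla h)(q,p)<0\}\subset T^*Q$ and $S^*_{\mathcal D}=S^*\cap\mathcal D^*$. The global nonholonomic vector field $\Xi_H^{\mathscr C}$ on $T^*Q$ is given by $$i_{\Xi_H^{\mathscr C}}\omega=dH-m_{\alpha\beta}\{H,P(W^\alpha)\}\,\pi_Q^*\eta^\beta .$$ The nonholonomic vector field $X_H^{\mathcal D}$ is the vector field on $\mathcal D^*$, tangent to $\mathcal D^*$, with $i_{X_H^{\mathcal D}}\omega=dH+\lambda_\alpha\pi_Q^*\eta^\alpha$ for suitable multipliers $\lambda_\alpha$; it is $\Xi_H^{\mathscr C}|_{\mathcal D^*}$. The global impact map $\Delta^{\mathscr C}:S^*\to T^*Q$ sends $(q,\mathbb FL(\dot q))$ to $(q,\mathbb FL(\dot q+\lambda_kW^k+\varepsilon\nabla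 h))$ with $$\varepsilon=\frac{2m_{\alpha\beta}dh(W^\beta)\eta^\alpha(\dot q)-2dh(\dot q)}{dh(\nabla h)-m_{\alpha\beta}dh(W^\alpha)dh(W^\beta)},\qquad \lambda_k=-2m_{k\ell}dh(W^\ell)\,\frac{m_{\alpha\beta}dh(W^\beta)\eta^\alpha(\dot q)-dh(\dot q)}{dh(\nabla h)-m_{\alpha\beta}dh(W^\alpha)dh(W^\beta)},$$ and the nonholonomic impact map $\Delta^{\mathcal D}:S^*_{\mathcal D}\to\mathcal D^*$ is given in the same way with $$\varepsilon=\frac{-2dh(\dot q)}{dh(\nabla h)-m_{\alpha\beta}dh(W^\alpha)dh(W^\beta)},\qquad \lambda_k=\frac{2m_{k\ell}dh(W^\ell)dh(\dot q)}{dh(\nabla h)-m_{\alpha\beta}dh(W^\alpha)dh(W^\beta)} .$$ The nonholonomic volume form on $\mathcal D^*$ is $\mu_{\mathscr C}=\iota^*\vartheta$, where $\iota:\mathcal D^*\hookrightarrow T^*Q$ is the inclusion and $\vartheta$ is any $(2n-m)$-form with $dP(W^1)\wedge\dots\wedge dP(W^m)\wedge\vartheta=\omega^n$ along $\mathcal D^*$;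 such $\vartheta$ exist and $\iota^*\vartheta$ does not depend on the choice. For a vector field $X$ on a manifold $M$, a hypersurface $\Sigma\subset M$, a smooth map $\Delta:\Sigma\to M$ and a volume form $\mu$ on $M$, the hybrid Jacobian $\mathcal J_\mu(\Delta)$ is the unique smooth function on $\Sigma$ with $\Delta^*(i_X\mu)=\mathcal J_\mu(\Delta)\cdot\iota_\Sigma^*(i_X\mu)$ as forms on $\Sigma$, where $\iota_\Sigma:\Sigma\hookrightarrow M$. **Theorem.** (1) For the global system $(T^*Q,S^*,\Xi_H^{\mathscr C},\Delta^{\mathscr C})$, the map $\Delta^{\mathscr C}$ is smooth on $S^*$, $\pi_Q^*dh(\Xi_H^{\mathscr C})$ does not vanish on $S^*$, and the hybrid Jacobian of $\Delta^{\mathscr C}$ with respect to $\omega^n$ exists, is unique, and equals $$\mathcal J_{\omega^n}(\Delta^{\mathscr C})=\frac{(2\,\pi_Q^*\pi_{\mathcal D}^*dh-\pi_Q^*dh)(\Xi_H^{\mathscr C})}{\pi_Q^*dh(\Xi_H^{\mathscr C})}\quad\text{on } S^* .$$ (2) For the nonholonomic system $(\mathcal D^*,S^*_{\mathcal D},X_H^{\mathcal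 D},\Delta^{\mathcal D})$, the map $\Delta^{\mathcal D}$ is smooth on $S^*_{\mathcal D}$ with values in $\mathcal D^*$, $\Xi_H^{\mathscr C}|_{\mathcal D^*}$ is the nonholonomic vector field, the volume form $\mu_{\mathscr C}$ is well defined, and the hybrid Jacobian of $\Delta^{\mathcal D}$ with respect to $\mu_{\mathscr C}$ exists, is unique, and is identically $1$ on $S^*_{\mathcal D}$. -/

import Mathlib

open scoped Manifold ContDiff Topology

noncomputable section

namespace NHImpact

/-! ### Exterior algebra of a real vector space -/

section Exterior

variable {V : Type*} [AddCommGroup V] [Module ℝ V]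

/-- The exterior product of alternating forms (sum over shuffles). -/
def wedge {k l : ℕ} (α : V [⋀^Fin k]→ₗ[ℝ] ℝ) (β : V [⋀^Fin l]→ₗ[ℝ] ℝ) :
    V [⋀^Fin (k + l)]→ₗ[ℝ] ℝ :=
  ((LinearMap.mul' ℝ ℝ).compAlternatingMap (α.domCoprod β)).domDomCongr finSumFinEquiv

/-- The `k`-th exterior power `θ ∧ ⋯ ∧ θ` of a 2-form. -/
def wedgePow (θ : V [⋀^Fin 2]→ₗ[ℝ] ℝ) : (k : ℕ) → V [⋀^Fin (2 * k)]→ₗ[ℝ] ℝ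
  | 0 => AlternatingMap.constOfIsEmpty ℝ V (Fin 0) (1 : ℝ)
  | k + 1 => wedge (wedgePow θ k) θ

/-- The exterior product `θ¹ ∧ ⋯ ∧ θᵐ` of `m` linear forms: its value on `(v₁, …, v_m)` is
`det (θⁱ(v_j))`. -/
def wedgeOneForms {m : ℕ} (θ : Fin m → V →ₗ[ℝ] ℝ) : V [⋀^Fin m]→ₗ[ℝ] ℝ :=
  (Matrix.detRowAlternating (R := ℝ) (n := Fin m)).compLinearMap (LinearMap.pi θ)

/-- The interior product `i_X α = α(X, ·, …, ·)`; it is zero on 0-forms. -/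
def interior : {d : ℕ} → (V [⋀^Fin d]→ₗ[ℝ] ℝ) → V → V [⋀^Fin (d - 1)]→ₗ[ℝ] ℝ
  | 0, _, _ => 0
  | _ + 1, α, X => α.curryLeft X

end Exterior

/-! ### Hybrid Jacobians -/

section Hybrid

variable {F : Type*} [NormedAddCommGroup F] [NormedSpace ℝ F]
  {H : Type*} [TopologicalSpace H] (I : ModelWithCorners ℝ F H)
  {M : Type*} [TopologicalSpace M] [ChartedSpace H M]

/-- The vectors at `x` tangent to the subset `S` of the manifold `M`: in the chart at `x` they lie
in the tangent cone (over `ℝ`, hence two-sided) of `S`. When `S` is an embedded submanifold and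
`x ∈ S` this is the tangent space `T_x S ⊆ T_x M`. -/
def tangentDirections (S : Set M) (x : M) : Set (TangentSpace I x) :=
  {v | mfderiv I 𝓘(ℝ, F) (extChartAt I x) x v ∈
    tangentConeAt ℝ ((extChartAt I x).target ∩ (extChartAt I x).symm ⁻¹' S) (extChartAt I x x)}

/-- `J` is a hybrid Jacobian of the impact map `Δ : S → M` with respect to the form `μ` for the
vector field `X`: `J` is smooth on `S` and `Δ^* ι^* i_X μ = J · ι_S^* i_X μ` as forms on `S`.
The tangent map of `Δ : S → M` on vectors tangent to `S` is the derivative of `Δ` within `S`.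

The same definition serves a system on a submanifold `N ⊆ M` with `S ⊆ N`, `Δ(S) ⊆ N`, `X` tangent
to `N` along `N`, and the volume form `ι_N^* μ`, because then only vectors tangent to `N` are
inserted into `μ`. -/
structure IsHybridJacobian (S : Set M) (X : ∀ x : M, TangentSpace I x) (Δ : M → M) {d : ℕ}
    (μ : ∀ x : M, (TangentSpace I x) [⋀^Fin d]→ₗ[ℝ] ℝ) (J : M → ℝ) : Prop where
  smooth : ContMDiffOn I 𝓘(ℝ, ℝ) ∞ J S
  pullback : ∀ x ∈ S, ∀ v : Fin (d - 1) → TangentSpace I x,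
    (∀ i, v i ∈ tangentDirections I S x) →
      interior (μ (Δ x)) (X (Δ x)) (fun i => mfderivWithin I I Δ S x (v i)) =
        J x * interior (μ x) (X x) v

end Hybrid

/-! ### The cotangent bundle and its symplectic form -/

section Cotangent

variable (E : Type*) [NormedAddCommGroup E] [NormedSpace ℝ E]

/-- The canonical 2-form `dq ∧ dp` on `E × E^*`: `ω((a, α), (b, β)) = β(a) - α(b)`. -/
def canonicalTwoForm : (E × (E →L[ℝ] ℝ)) [⋀^Fin 2]→ₗ[ℝ] ℝ where
  toFun v := (v 1).2 (v 0).1 - (v 0).2 (v 1).1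
  map_update_add' := by
    intro hd v i x y
    have : hd = instDecidableEqFin 2 := Subsingleton.elim _ _
    subst this
    fin_cases i <;> simp <;> ring
  map_update_smul' := by
    intro hd v i c x
    have : hd = instDecidableEqFin 2 := Subsingleton.elim _ _
    subst this
    fin_cases i <;> simp <;> ring
  map_eq_zero_of_eq' := by
    intro v i j h hij
    have : v 0 = v 1 := by
      fin_cases i <;> fin_cases j <;> simp_all
    simp [this]

variable {E}
variable (Q : Type*) [TopologicalSpace Q] [ChartedSpace E Q] [IsManifold 𝓘(ℝ, E) ∞ Q]

/-- The cotangent space `T_q^* Q`. -/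
abbrev CotangentSpace (q : Q) : Type _ :=
  TangentSpace 𝓘(ℝ, E) q →L[ℝ] Bundle.Trivial Q ℝ q

/-- The cotangent bundle `T^*Q`. -/
abbrev CotangentBundle : Type _ :=
  Bundle.TotalSpace (E →L[ℝ] ℝ) (fun q : Q => CotangentSpace (E := E) Q q)

variable (E) in
/-- The model with corners of `T^*Q`. -/
abbrev modelT : ModelWithCorners ℝ (E × (E →L[ℝ] ℝ)) (ModelProd E (E →L[ℝ] ℝ)) :=
  𝓘(ℝ, E).prod 𝓘(ℝ, E →L[ℝ] ℝ)

variable {Q}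

/-- The tangent space of `T^*Q` at `x` in the coordinates of the bundle chart at `x`. -/
def chartTangent (x : CotangentBundle (E := E) Q) :
    TangentSpace (modelT E) x →ₗ[ℝ] E × (E →L[ℝ] ℝ) where
  toFun v := mfderiv (modelT E) 𝓘(ℝ, E × (E →L[ℝ] ℝ)) (extChartAt (modelT E) x) x v
  map_add' u v := map_add _ u v
  map_smul' c v := map_smul _ c v

/-- The symplectic form `ω = dqⁱ ∧ dpᵢ` on `T^*Q`. At `x` it is computed in the bundle chart
of `T^*Q` at `x`, which consists of the canonical coordinates `(qⁱ, pᵢ)` induced by the chart of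
`Q` at the base point of `x`. -/
def symplecticForm (x : CotangentBundle (E := E) Q) :
    (TangentSpace (modelT E) x) [⋀^Fin 2]→ₗ[ℝ] ℝ :=
  (canonicalTwoForm E).compLinearMap (chartTangent x)

/-- The vector `X` at `x` with `i_X ω = ν` (it exists and is unique since `ω` is nondegenerate). -/
def symplecticDual (x : CotangentBundle (E := E) Q) (ν : TangentSpace (modelT E) x →ₗ[ℝ] ℝ) :
    TangentSpace (modelT E) x :=
  Classical.epsilon fun X => ∀ v, symplecticForm x ![X, v] = ν v

/-- The differential of a real function on `T^*Q`. -/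
def dT (f : CotangentBundle (E := E) Q → ℝ) (x : CotangentBundle (E := E) Q) :
    TangentSpace (modelT E) x →ₗ[ℝ] ℝ where
  toFun v := mfderiv (modelT E) 𝓘(ℝ, ℝ) f x v
  map_add' u v := map_add _ u v
  map_smul' c v := map_smul _ c v

/-- The Poisson bracket `{f, k} = ω(X_f, X_k)`, where `i_{X_f} ω = df`. -/
def poisson (f k : CotangentBundle (E := E) Q → ℝ) (x : CotangentBundle (E := E) Q) : ℝ :=
  symplecticForm x ![symplecticDual x (dT f x), symplecticDual x (dT k x)]

/-- The pullback `π_Q^* α` at `x` of a covector `α` on `Q` at the base point of `x`. -/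
def pullbackT (x : CotangentBundle (E := E) Q) (α : CotangentSpace (E := E) Q x.proj) :
    TangentSpace (modelT E) x →ₗ[ℝ] ℝ where
  toFun v := α (mfderiv (modelT E) 𝓘(ℝ, E)
    (fun y : CotangentBundle (E := E) Q => y.proj) x v)
  map_add' u v := by rw [map_add, map_add]
  map_smul' c v := by rw [map_smul, map_smul]; rfl

/-- The momentum function `P(W)(q, p) = ⟨p, W(q)⟩` of a vector field `W` on `Q`. -/
def momentum (W : ∀ q : Q, TangentSpace 𝓘(ℝ, E) q) (x : CotangentBundle (E := E) Q) : ℝ :=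
  x.2 (W x.proj)

end Cotangent

/-! ### Nonholonomic impact systems -/

section System

variable {E : Type*} [NormedAddCommGroup E] [NormedSpace ℝ E] [FiniteDimensional ℝ E]
variable (E) (Q : Type*) [TopologicalSpace Q] [ChartedSpace E Q] [IsManifold 𝓘(ℝ, E) ∞ Q]

/-- The data of a nonholonomic impact system with natural Lagrangian on `Q`: a Riemannian metric
`g`, a potential `V`, a realization `𝒞 = {η¹, …, ηᵐ}` of the constraints by pointwise linearly
independent 1-forms, and a function `h` whose zero set is the location of the impacts. -/
structure ImpactSystem (m : ℕ) where
  g : Bundle.ContMDiffRiemannianMetric 𝓘(ℝ, E) ∞ E (fun q : Q => TangentSpace 𝓘(ℝ, E) q)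
  V : Q → ℝ
  V_smooth : ContMDiff 𝓘(ℝ, E) 𝓘(ℝ, ℝ) ∞ V
  η : Fin m → ∀ q : Q, CotangentSpace (E := E) Q q
  η_smooth : ∀ a, ContMDiff 𝓘(ℝ, E) (modelT E) ∞
    (fun q => (⟨q, η a q⟩ : CotangentBundle (E := E) Q))
  η_indep : ∀ q, LinearIndependent ℝ (fun a => η a q)
  h : Q → ℝ
  h_smooth : ContMDiff 𝓘(ℝ, E) 𝓘(ℝ, ℝ) ∞ h
  /-- The nontrivial impact condition: on `h = 0`, `dh` does not annihilate the distribution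
  `𝒟 = ⋂ ker ηᵃ`. -/
  nontrivial_impact : ∀ q, h q = 0 →
    ∃ v : TangentSpace 𝓘(ℝ, E) q, (∀ a, η a q v = 0) ∧ mfderiv 𝓘(ℝ, E) 𝓘(ℝ, ℝ) h q v ≠ 0

variable {E Q} {m : ℕ}

namespace ImpactSystem

variable (s : ImpactSystem E Q m)

/-- The fiber derivative `𝔽L(v) = g(v, ·)` of the natural Lagrangian. -/
def flat (q : Q) : TangentSpace 𝓘(ℝ, E) q →L[ℝ] CotangentSpace (E := E) Q q := s.g.inner q

/-- The inverse `𝔽L⁻¹` of the fiber derivative. -/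
def sharp (q : Q) : CotangentSpace (E := E) Q q →L[ℝ] TangentSpace 𝓘(ℝ, E) q :=
  (s.flat q).inverse

/-- The natural Lagrangian `L(q, v) = ½ g(v, v) - V(q)`. -/
def lagrangian (q : Q) (v : TangentSpace 𝓘(ℝ, E) q) : ℝ :=
  1 / 2 * s.g.inner q v v - s.V q

/-- The Hamiltonian `H(q, p) = p(v) - L(q, v)` with `p = 𝔽L(v)`. -/
def hamiltonian (x : CotangentBundle (E := E) Q) : ℝ :=
  x.2 (s.sharp x.proj x.2) - s.lagrangian x.proj (s.sharp x.proj x.2)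

/-- The differential of `h`. -/
def dh (q : Q) : CotangentSpace (E := E) Q q := mfderiv 𝓘(ℝ, E) 𝓘(ℝ, ℝ) s.h q

/-- The gradient of `h`. -/
def gradh (q : Q) : TangentSpace 𝓘(ℝ, E) q := s.sharp q (s.dh q)

/-- The dual vector fields `Wᵃ = 𝔽L⁻¹ ηᵃ`. -/
def W (a : Fin m) (q : Q) : TangentSpace 𝓘(ℝ, E) q := s.sharp q (s.η a q)

/-- The constraint mass matrix `m^{ab} = g(Wᵃ, Wᵇ)`. -/
def massMatrix (q : Q) : Matrix (Fin m) (Fin m) ℝ :=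
  Matrix.of fun a b => s.g.inner q (s.W a q) (s.W b q)

/-- The inverse `m_{ab}` of the constraint mass matrix. -/
def massInv (q : Q) : Matrix (Fin m) (Fin m) ℝ := (s.massMatrix q)⁻¹

/-- The `g`-orthogonal projection `π_𝒟 v = v - m_{ab} ηᵃ(v) Wᵇ` of `T_q Q` onto `𝒟_q`. -/
def projD (q : Q) (v : TangentSpace 𝓘(ℝ, E) q) : TangentSpace 𝓘(ℝ, E) q :=
  v - ∑ a, ∑ b, (s.massInv q a b * s.η a q v : ℝ) • s.W b q

/-- The constraint manifold `𝒟^* = 𝔽L(𝒟) = {P(Wᵃ) = 0}` in `T^*Q`. -/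
def Dstar : Set (CotangentBundle (E := E) Q) :=
  {x | ∀ a, s.η a x.proj (s.sharp x.proj x.2) = 0}

/-- The impact surface `S^* = {h = 0, P(∇h) < 0}` in `T^*Q`. -/
def Sstar : Set (CotangentBundle (E := E) Q) :=
  {x | s.h x.proj = 0 ∧ momentum s.gradh x < 0}

/-- The impact surface `S^*_𝒟 = S^* ∩ 𝒟^*` of the nonholonomic system. -/
def SstarD : Set (CotangentBundle (E := E) Q) := s.Sstar ∩ s.Dstar

/-- The denominator `dh(∇h) - m_{ab} dh(Wᵃ) dh(Wᵇ)` of the impact multipliers. -/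
def impactDenom (q : Q) : ℝ :=
  s.dh q (s.gradh q) - ∑ a, ∑ b, s.massInv q a b * s.dh q (s.W a q) * s.dh q (s.W b q)

/-- The multiplier `ε` of the global impact map. -/
def epsC (q : Q) (v : TangentSpace 𝓘(ℝ, E) q) : ℝ :=
  (2 * (∑ a, ∑ b, s.massInv q a b * s.dh q (s.W b q) * s.η a q v) - 2 * s.dh q v) /
    s.impactDenom q

/-- The multipliers `λ_k` of the global impact map. -/
def lamC (q : Q) (v : TangentSpace 𝓘(ℝ, E) q) (k : Fin m) : ℝ :=
  -2 * (∑ l, s.massInv q k l * s.dh q (s.W l q)) *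
    (((∑ a, ∑ b, s.massInv q a b * s.dh q (s.W b q) * s.η a q v) - s.dh q v) /
      s.impactDenom q)

/-- The global nonholonomic impact map `Δ^𝒞` on `T^*Q`:
`v⁺ = v + λ_k Wᵏ + ε ∇h`, transported to momenta by `𝔽L`. -/
def impactC (x : CotangentBundle (E := E) Q) : CotangentBundle (E := E) Q :=
  let v := s.sharp x.proj x.2
  ⟨x.proj, s.flat x.proj
    (v + ∑ k, s.lamC x.proj v k • s.W k x.proj + s.epsC x.proj v • s.gradh x.proj)⟩

/-- The multiplier `ε` of the (local) nonholonomic impact map. -/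
def epsD (q : Q) (v : TangentSpace 𝓘(ℝ, E) q) : ℝ :=
  -2 * s.dh q v / s.impactDenom q

/-- The multipliers `λ_k` of the (local) nonholonomic impact map. -/
def lamD (q : Q) (v : TangentSpace 𝓘(ℝ, E) q) (k : Fin m) : ℝ :=
  2 * (∑ l, s.massInv q k l * s.dh q (s.W l q) * s.dh q v) / s.impactDenom q

/-- The nonholonomic impact map `Δ^𝒟`, of which only the values on `S^*_𝒟` matter. -/
def impactD (x : CotangentBundle (E := E) Q) : CotangentBundle (E := E) Q :=
  let v := s.sharp x.proj x.2
  ⟨x.proj, s.flat x.proj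
    (v + ∑ k, s.lamD x.proj v k • s.W k x.proj + s.epsD x.proj v • s.gradh x.proj)⟩

/-- The nonholonomic 1-form `ν_H^𝒞 = dH - m_{ab} {H, P(Wᵃ)} π_Q^* ηᵇ`. -/
def nhOneForm (x : CotangentBundle (E := E) Q) : TangentSpace (modelT E) x →ₗ[ℝ] ℝ :=
  dT s.hamiltonian x - ∑ a, ∑ b,
    (s.massInv x.proj a b * poisson s.hamiltonian (momentum (s.W a)) x) •
      pullbackT x (s.η b x.proj)

/-- The global nonholonomic vector field `Ξ_H^𝒞`, given by `i_Ξ ω = ν_H^𝒞`. -/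
def nhField (x : CotangentBundle (E := E) Q) : TangentSpace (modelT E) x :=
  symplecticDual x (s.nhOneForm x)

/-- `X` is, along `𝒟^*`, the nonholonomic vector field `X_H^𝒟`: it is tangent to `𝒟^*` and
`i_X ω = dH + λ_a π_Q^* ηᵃ` for suitable multipliers. -/
def IsNonholonomicField (X : ∀ x : CotangentBundle (E := E) Q, TangentSpace (modelT E) x) : Prop :=
  ∀ x ∈ s.Dstar, (∀ a, dT (momentum (s.W a)) x (X x) = 0) ∧
    ∃ lam : Fin m → ℝ, ∀ v, symplecticForm x ![X x, v] =
      dT s.hamiltonian x v + ∑ a, lam a * pullbackT x (s.η a x.proj) v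

/-- The volume form `ωⁿ` on `T^*Q`, where `n = dim Q`. -/
def liouville (x : CotangentBundle (E := E) Q) :
    (TangentSpace (modelT E) x) [⋀^Fin (2 * Module.finrank ℝ E)]→ₗ[ℝ] ℝ :=
  wedgePow (symplecticForm x) (Module.finrank ℝ E)

/-- The form `σ_𝒞 = dP(W¹) ∧ ⋯ ∧ dP(Wᵐ)`. -/
def sigma (x : CotangentBundle (E := E) Q) : (TangentSpace (modelT E) x) [⋀^Fin m]→ₗ[ℝ] ℝ :=
  wedgeOneForms fun a => dT (momentum (s.W a)) x

/-- `ε` represents the nonholonomic volume form: `σ_𝒞 ∧ ε = ωⁿ` along `𝒟^*`, so that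
`μ_𝒞 = ι^* ε` for the inclusion `ι : 𝒟^* → T^*Q`. -/
def RepresentsNHVolume (ε : ∀ x : CotangentBundle (E := E) Q,
    (TangentSpace (modelT E) x) [⋀^Fin (2 * Module.finrank ℝ E - m)]→ₗ[ℝ] ℝ) : Prop :=
  ∀ x ∈ s.Dstar, ∃ e : m + (2 * Module.finrank ℝ E - m) = 2 * Module.finrank ℝ E,
    (wedge (s.sigma x) (ε x)).domDomCongr (finCongr e) = liouville x

/-- The function `π_Q^* dh (Ξ_H^𝒞)`. -/
def dhField (x : CotangentBundle (E := E) Q) : ℝ :=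
  pullbackT x (s.dh x.proj) (s.nhField x)

/-- The function `π_Q^* π_𝒟^* dh (Ξ_H^𝒞)`. -/
def dhProjField (x : CotangentBundle (E := E) Q) : ℝ :=
  s.dh x.proj (s.projD x.proj (mfderiv (modelT E) 𝓘(ℝ, E)
    (fun y : CotangentBundle (E := E) Q => y.proj) x (s.nhField x)))

end ImpactSystem

end System

end NHImpact

end

/-! ### Exterior powers of a 2-form and top forms. -/

noncomputable section

namespace NHImpact

section ExteriorAlgebra

variable {V : Type*} [AddCommGroup V] [Module ℝ V]

/-! Let `gradhD` be the component of ∇h in 𝒟 and `dhD` its covector, which is dh composed with the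
orthogonal projection. The multipliers of the global impact combine to λ_k Wᵏ + ε∇h = ε·`gradhD`. In
momenta the impact is therefore p ↦ p − 2 (p(`gradhD`) / `dhD`(`gradhD`)) `dhD`, a linear reflection
of each relevant cotangent fiber over the identity of Q (`impactC_eq`). Its tangent map F is block
triangular, with the identity on the base and a reflection on the fiber, so det F = −1
(`det_dImpact`), and F preserves the pullback of dh.

Let X and Y be the field at x and at Δ(x), and choose j with dh(Y) = −j dh(X). Then Y + j F X is
annihilated by dh, so a top form vanishes on it together with the images F vᵢ of a frame of the
impact surface. Hence μ(Y, F v) = −j μ(F X, F v) = −j det F μ(X, v) = j μ(X, v), and the Jacobian is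
−dh(Y)/dh(X) (`IsFormQuotient.interior_map`).

Constraint forces are pulled back from Q and invisible to vertical vectors, so the base part of
either field is the velocity 𝔽L⁻¹p and dh(X) = P(∇h) (`fst_of_symplectic_eq`). The impact changes
P(∇h) into P(∇h) − 2 P(`gradhD`) (`momentum_gradh_impactC`), which gives the global formula. On 𝒟^*
the two momenta agree, and the quotient becomes 1.

The form μ_𝒞 arises from ωⁿ by inserting vectors dual to dP(Wᵃ). The functions P(Wᵃ) are invariant
under the impact because `dhD` kills Wᵃ, so F carries dual vectors to dual vectors and the same
computation applies. Both cases are instances of `isHybridJacobian_and_unique`, with 0 or m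
invariant constraints. Uniqueness holds because X is transverse to the impact surface, so i_X μ is
nonzero on its tangent spaces; the implicit function theorem shows that the tangent cones are these
full spaces. -/

/-- Every shuffle other than the identity coset feeds some `w j` to `α`, so only one summand
survives. -/
lemma wedge_append_of_vanish {k l : ℕ} (α : V [⋀^Fin k]→ₗ[ℝ] ℝ) (β : V [⋀^Fin l]→ₗ[ℝ] ℝ)
    (v : Fin k → V) (w : Fin l → V) (h : ∀ u : Fin k → V, (∃ i j, u i = w j) → α u = 0) :
    wedge α β (Fin.append v w) = α v * β w := by
  have key : (α.domCoprod β) (fun i => Fin.append v w (finSumFinEquiv i)) = α v ⊗ₜ[ℝ] β w := by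
    rw [← AlternatingMap.coe_multilinearMap, AlternatingMap.domCoprod_coe,
      sum_apply]
    refine (Finset.sum_eq_single (Quotient.mk'' 1) ?_ ?_).trans ?_
    · intro σ _
      induction σ using Quotient.inductionOn' with
      | h σ =>
        intro hσ
        have hex : ∃ i j, σ (Sum.inl i) = Sum.inr j := by
          by_contra! hne
          refine hσ (Quotient.sound' ?_)
          rw [QuotientGroup.leftRel_apply]
          refine mul_mem (inv_mem (Equiv.Perm.mem_sumCongrHom_range_of_perm_mapsTo_inl ?_))
            (one_mem _)
          rintro _ ⟨i, rfl⟩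
          rcases hi : σ (Sum.inl i) with a | b
          · exact ⟨a, rfl⟩
          · exact absurd hi (hne i b)
        obtain ⟨i, j, hij⟩ := hex
        rw [AlternatingMap.domCoprod.summand_mk'']
        simp only [smul_apply, MultilinearMap.domDomCongr_apply, MultilinearMap.domCoprod_apply,
          AlternatingMap.coe_multilinearMap]
        rw [h _ ⟨i, j, by simp [hij]⟩, TensorProduct.zero_tmul, smul_zero]
    · simp
    · simp [AlternatingMap.domCoprod.summand_mk'']
  have : wedge α β (Fin.append v w) =
      LinearMap.mul' ℝ ℝ ((α.domCoprod β) (fun i => Fin.append v w (finSumFinEquiv i))) := rfl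
  rw [this, key, LinearMap.mul'_apply]

/-- The tensor power of a bilinear form. -/
def tensorPow (b : MultilinearMap ℝ (fun _ : Fin 2 => V) ℝ) :
    (k : ℕ) → MultilinearMap ℝ (fun _ : Fin (2 * k) => V) ℝ
  | 0 => MultilinearMap.constOfIsEmpty ℝ (fun _ : Fin 0 => V) (1 : ℝ)
  | k + 1 => ((LinearMap.mul' ℝ ℝ).compMultilinearMap
      ((tensorPow b k).domCoprod b)).domDomCongr finSumFinEquiv

lemma tensorPow_apply (b : MultilinearMap ℝ (fun _ : Fin 2 => V) ℝ) (k : ℕ)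
    (v : Fin (2 * k) → V) :
    tensorPow b k v = ∏ i : Fin k, b ![v ⟨2 * i, by omega⟩, v ⟨2 * i + 1, by omega⟩] := by
  induction k with
  | zero => rfl
  | succ k ih =>
    rw [Fin.prod_univ_castSucc]
    have : tensorPow b (k + 1) v =
      tensorPow b k (fun i => v (finSumFinEquiv (Sum.inl i))) *
        b (fun i => v (finSumFinEquiv (m := 2 * k) (Sum.inr i))) := rfl
    rw [this, ih]
    congr 2
    ext i
    fin_cases i <;> rfl

/-- This turns the sum over shuffles into a sum over all permutations of products of values of `b`,
where signs can be controlled. -/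
lemma wedgePow_alternatization (b : MultilinearMap ℝ (fun _ : Fin 2 => V) ℝ) (k : ℕ) :
    wedgePow (MultilinearMap.alternatization b) k =
      MultilinearMap.alternatization (tensorPow b k) := by
  induction k with
  | zero =>
    ext v
    rw [MultilinearMap.alternatization_apply]
    simp [wedgePow, tensorPow]
  | succ k ih =>
    rw [wedgePow, ih, wedge, ← MultilinearMap.domCoprod_alternization]
    ext v
    simp only [AlternatingMap.domDomCongr_apply, LinearMap.compAlternatingMap_apply,
      MultilinearMap.alternatization_apply, map_sum]
    refine Eq.trans ?_ (Equiv.sum_comp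
      (Equiv.permCongr (finSumFinEquiv (m := 2 * k) (n := 2))) _)
    refine Finset.sum_congr rfl fun σ _ => ?_
    rw [Equiv.Perm.sign_permCongr]
    simp only [tensorPow, MultilinearMap.domDomCongr_apply, Units.smul_def, map_zsmul,
      LinearMap.compMultilinearMap_apply]
    simp [Equiv.permCongr_apply]

lemma top_form_eq_zero {N : ℕ} [FiniteDimensional ℝ V] (hN : Module.finrank ℝ V = N)
    (μ : V [⋀^Fin N]→ₗ[ℝ] ℝ) (u : Fin N → V) (hu : ⊤ ≤ Submodule.span ℝ (Set.range u))
    (h : μ u = 0) : μ = 0 := by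
  have hb := coe_basisOfTopLeSpanOfCardEqFinrank u hu (by simp [hN])
  have := μ.eq_smul_basis_det (basisOfTopLeSpanOfCardEqFinrank u hu (by simp [hN]))
  rw [hb, h, zero_smul] at this
  exact this

lemma top_form_comp {N : ℕ} [FiniteDimensional ℝ V] (hN : Module.finrank ℝ V = N)
    (μ : V [⋀^Fin N]→ₗ[ℝ] ℝ) (F : V →ₗ[ℝ] V) (u : Fin N → V) :
    μ (F ∘ u) = LinearMap.det F * μ u := by
  let b := Module.finBasisOfFinrankEq ℝ V hN
  rw [μ.eq_smul_basis_det b]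
  simp [Module.Basis.det_comp]
  ring

end ExteriorAlgebra

/-! ### The canonical volume form on E × E^* is nonzero. -/

section Canonical

variable (E : Type*) [NormedAddCommGroup E] [NormedSpace ℝ E]

/-- The bilinear form `(u, w) ↦ w.2 u.1`, whose alternatization is the canonical 2-form. -/
def pairing : MultilinearMap ℝ (fun _ : Fin 2 => E × (E →L[ℝ] ℝ)) ℝ where
  toFun v := (v 1).2 (v 0).1
  map_update_add' := by
    intro hd v i x y
    have : hd = instDecidableEqFin 2 := Subsingleton.elim _ _
    subst this
    fin_cases i <;> simp
  map_update_smul' := by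
    intro hd v i c x
    have : hd = instDecidableEqFin 2 := Subsingleton.elim _ _
    subst this
    fin_cases i <;> simp

lemma alternatization_pairing :
    MultilinearMap.alternatization (pairing E) = canonicalTwoForm E := by
  ext v
  rw [MultilinearMap.alternatization_apply]
  have : (Finset.univ : Finset (Equiv.Perm (Fin 2))) = {1, Equiv.swap 0 1} := by decide
  rw [this, Finset.sum_insert (by decide), Finset.sum_singleton]
  simp only [MultilinearMap.domDomCongr_apply, Equiv.Perm.sign_one, one_smul,
    Equiv.Perm.sign_swap (show (0 : Fin 2) ≠ 1 by decide), Units.neg_smul]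
  change (v 1).2 (v 0).1 + -((v (Equiv.swap 0 1 1)).2 (v (Equiv.swap 0 1 0)).1) = _
  rw [Equiv.swap_apply_left, Equiv.swap_apply_right, ← sub_eq_add_neg]
  rfl

/-- The equivalence `(i, s) ↦ 2 i + s`. -/
def pairIndex (n : ℕ) : Fin n × Fin 2 ≃ Fin (2 * n) :=
  finProdFinEquiv.trans (finCongr (mul_comm n 2))

/-- Such a permutation is two copies of one permutation of `Fin n`, so its sign is a square. -/
lemma sign_eq_one_of_preserves_pairs {n : ℕ} (τ : Equiv.Perm (Fin n × Fin 2))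
    (h : ∀ i, (τ (i, 0)).2 = 0 ∧ (τ (i, 1)).2 = 1 ∧ (τ (i, 0)).1 = (τ (i, 1)).1) :
    Equiv.Perm.sign τ = 1 := by
  have hinj : Function.Injective fun i => (τ (i, 0)).1 := by
    intro i j hij
    have : τ (i, 0) = τ (j, 0) := Prod.ext hij ((h i).1.trans (h j).1.symm)
    simpa using τ.injective this
  let π : Equiv.Perm (Fin n) := Equiv.ofBijective _ hinj.bijective_of_finite
  have : τ = Equiv.prodCongrLeft (fun _ : Fin 2 => π) := by
    ext ⟨i, s⟩ : 1
    have hp : π i = (τ (i, 0)).1 := rfl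
    fin_cases s
    · exact Prod.ext rfl (h i).1
    · exact Prod.ext (h i).2.2.symm (h i).2.1
  rw [this, Equiv.Perm.sign_prodCongrLeft]
  simp

/-- On the basis q₁, p₁, q₂, p₂, … a permutation contributes only if it carries each pair (qᵢ, pᵢ)
to a pair (qⱼ, pⱼ). It is then even, so no term is negative, and the identity contributes 1. -/
lemma wedgePow_canonical_ne_zero [FiniteDimensional ℝ E] :
    wedgePow (canonicalTwoForm E) (Module.finrank ℝ E) ≠ 0 := by
  set n := Module.finrank ℝ E with hn
  let b : Module.Basis (Fin n) ℝ E := Module.finBasis ℝ E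
  let e : Fin n × Fin 2 → E × (E →L[ℝ] ℝ) := fun p =>
    if p.2 = 0 then (b p.1, 0) else (0, LinearMap.toContinuousLinearMap (b.coord p.1))
  have he : ∀ p q, pairing E ![e p, e q] = if p.2 = 0 ∧ q.2 = 1 ∧ p.1 = q.1 then 1 else 0 := by
    rintro ⟨i, s⟩ ⟨j, t⟩
    change (e (j, t)).2 (e (i, s)).1 = _
    fin_cases s <;> fin_cases t <;> simp [e, Finsupp.single_apply]
  let v : Fin (2 * n) → E × (E →L[ℝ] ℝ) := fun k => e ((pairIndex n).symm k)
  have h0 : ∀ i : Fin n, (⟨2 * i, by omega⟩ : Fin (2 * n)) = pairIndex n (i, 0) := by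
    intro i; ext; simp [pairIndex]
  have h1 : ∀ i : Fin n, (⟨2 * i + 1, by omega⟩ : Fin (2 * n)) = pairIndex n (i, 1) := by
    intro i; ext; simp [pairIndex]; ring
  suffices 0 < wedgePow (canonicalTwoForm E) n v by
    intro h
    rw [h] at this
    simp at this
  rw [← alternatization_pairing, wedgePow_alternatization, MultilinearMap.alternatization_apply]
  have hterm : ∀ σ : Equiv.Perm (Fin (2 * n)),
      MultilinearMap.domDomCongr σ (tensorPow (pairing E) n) v =
        ∏ i, pairing E ![e ((pairIndex n).symm (σ (pairIndex n (i, 0)))),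
          e ((pairIndex n).symm (σ (pairIndex n (i, 1))))] := by
    intro σ
    rw [MultilinearMap.domDomCongr_apply, tensorPow_apply]
    refine Finset.prod_congr rfl fun i _ => ?_
    rw [h0, h1]
  refine Finset.sum_pos' (fun σ _ => ?_) ⟨1, Finset.mem_univ _, ?_⟩
  · rw [hterm]
    by_cases hz : ∏ i, pairing E ![e ((pairIndex n).symm (σ (pairIndex n (i, 0)))),
          e ((pairIndex n).symm (σ (pairIndex n (i, 1))))] = 0
    · rw [hz, smul_zero]
    · have hs : Equiv.Perm.sign ((pairIndex n).symm.permCongr σ) = 1 := by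
        apply sign_eq_one_of_preserves_pairs
        intro i
        have := (Finset.prod_ne_zero_iff.1 hz) i (Finset.mem_univ _)
        rw [he] at this
        by_contra hc
        exact this (if_neg hc)
      rw [Equiv.Perm.sign_permCongr] at hs
      rw [hs, one_smul]
      refine Finset.prod_nonneg fun i _ => ?_
      rw [he]
      split_ifs <;> simp
  · rw [hterm]
    simp [he]

end Canonical

end NHImpact
end

/-! ### Dividing a top form by independent linear forms. -/

noncomputable section

namespace NHImpact

section Quotient

variable {V : Type*} [AddCommGroup V] [Module ℝ V]

/-- `ε` is obtained on the common kernel of the `θ a` from the form `μ` by inserting any vectors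
dual to the `θ a`. -/
def IsFormQuotient {m d N : ℕ} (e : m + d = N) (θ : Fin m → V →ₗ[ℝ] ℝ) (μ : V [⋀^Fin N]→ₗ[ℝ] ℝ)
    (ε : V [⋀^Fin d]→ₗ[ℝ] ℝ) : Prop :=
  ∀ (D : Fin m → V) (w : Fin d → V), (∀ a b, θ a (D b) = if a = b then 1 else 0) →
    (∀ a j, θ a (w j) = 0) → ε w = μ (Fin.append D w ∘ Fin.cast e.symm)

lemma wedgeOneForms_dual {m : ℕ} (θ : Fin m → V →ₗ[ℝ] ℝ) (D : Fin m → V)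
    (hD : ∀ a b, θ a (D b) = if a = b then 1 else 0) : wedgeOneForms θ D = 1 := by
  change Matrix.det (fun i j => θ j (D i)) = 1
  have : (fun i j => θ j (D i)) = (1 : Matrix (Fin m) (Fin m) ℝ) := by
    ext i j
    rw [hD, Matrix.one_apply]
    simp [eq_comm]
  rw [this, Matrix.det_one]

lemma wedgeOneForms_eq_zero {m : ℕ} (θ : Fin m → V →ₗ[ℝ] ℝ) (u : Fin m → V) (i : Fin m)
    (hu : ∀ a, θ a (u i) = 0) : wedgeOneForms θ u = 0 := by
  change Matrix.det (fun i j => θ j (u i)) = 0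
  exact Matrix.det_eq_zero_of_row_eq_zero i hu

lemma wedge_wedgeOneForms_append {m d : ℕ} (θ : Fin m → V →ₗ[ℝ] ℝ) (ε : V [⋀^Fin d]→ₗ[ℝ] ℝ)
    (D : Fin m → V) (w : Fin d → V) (hD : ∀ a b, θ a (D b) = if a = b then 1 else 0)
    (hw : ∀ a j, θ a (w j) = 0) : wedge (wedgeOneForms θ) ε (Fin.append D w) = ε w := by
  rw [wedge_append_of_vanish, wedgeOneForms_dual θ D hD, one_mul]
  rintro u ⟨i, j, hij⟩
  exact wedgeOneForms_eq_zero θ u i fun a => by rw [hij, hw]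

/-- This trades the wedge equation for an evaluation rule on the common kernel, the only property of
the quotient form used later. -/
lemma isFormQuotient_of_wedge_eq {m d N : ℕ} (e : m + d = N) (θ : Fin m → V →ₗ[ℝ] ℝ)
    (μ : V [⋀^Fin N]→ₗ[ℝ] ℝ) (ε : V [⋀^Fin d]→ₗ[ℝ] ℝ)
    (h : (wedge (wedgeOneForms θ) ε).domDomCongr (finCongr e) = μ) : IsFormQuotient e θ μ ε := by
  subst e
  intro D w hD hw
  rw [← h]
  exact (wedge_wedgeOneForms_append θ ε D w hD hw).symm

lemma span_append_eq_top {m d : ℕ} (θ : Fin m → V →ₗ[ℝ] ℝ) (D : Fin m → V) (w : Fin d → V)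
    (hD : ∀ a b, θ a (D b) = if a = b then 1 else 0)
    (hw : ∀ v, (∀ a, θ a v = 0) → v ∈ Submodule.span ℝ (Set.range w)) :
    ⊤ ≤ Submodule.span ℝ (Set.range (Fin.append D w)) := by
  rintro v -
  have h1 : v - ∑ b, θ b v • D b ∈ Submodule.span ℝ (Set.range w) := by
    apply hw
    intro a
    simp [hD]
  have h2 : ∑ b, θ b v • D b ∈ Submodule.span ℝ (Set.range D) :=
    Submodule.sum_mem _ fun b _ => Submodule.smul_mem _ _ (Submodule.subset_span ⟨b, rfl⟩)
  have hr : Set.range D ⊆ Set.range (Fin.append D w) := by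
    rintro _ ⟨b, rfl⟩
    exact ⟨Fin.castAdd d b, by simp⟩
  have hr' : Set.range w ⊆ Set.range (Fin.append D w) := by
    rintro _ ⟨b, rfl⟩
    exact ⟨Fin.natAdd m b, by simp⟩
  simpa using add_mem (Submodule.span_mono hr' h1) (Submodule.span_mono hr h2)

variable [FiniteDimensional ℝ V]

/-- The common kernel of linear forms. -/
def commonKer {m : ℕ} (θ : Fin m → V →ₗ[ℝ] ℝ) : Submodule ℝ V := LinearMap.ker (LinearMap.pi θ)

omit [FiniteDimensional ℝ V] in
lemma mem_commonKer {m : ℕ} {θ : Fin m → V →ₗ[ℝ] ℝ} {v : V} :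
    v ∈ commonKer θ ↔ ∀ a, θ a v = 0 := by
  simp [commonKer, LinearMap.mem_ker, funext_iff]

lemma finrank_commonKer {m : ℕ} (θ : Fin m → V →ₗ[ℝ] ℝ) (D : Fin m → V)
    (hD : ∀ a b, θ a (D b) = if a = b then 1 else 0) :
    m + Module.finrank ℝ (commonKer θ) = Module.finrank ℝ V := by
  have hs : LinearMap.range (LinearMap.pi θ) = ⊤ := by
    rw [LinearMap.range_eq_top]
    intro y
    refine ⟨∑ b, y b • D b, ?_⟩
    ext a
    simp [hD]
  have := LinearMap.finrank_range_add_finrank_ker (LinearMap.pi θ)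
  rw [hs, finrank_top, Module.finrank_fin_fun] at this
  exact this

/-- Top forms are divisible by a product of independent linear forms. -/
lemma exists_wedge_eq {m d N : ℕ} (e : m + d = N) (hN : Module.finrank ℝ V = N)
    (θ : Fin m → V →ₗ[ℝ] ℝ) (D : Fin m → V) (hD : ∀ a b, θ a (D b) = if a = b then 1 else 0)
    (μ : V [⋀^Fin N]→ₗ[ℝ] ℝ) :
    ∃ ε : V [⋀^Fin d]→ₗ[ℝ] ℝ, (wedge (wedgeOneForms θ) ε).domDomCongr (finCongr e) = μ := by
  subst e
  have hd : Module.finrank ℝ (commonKer θ) = d := by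
    have := finrank_commonKer θ D hD
    omega
  let b := Module.finBasisOfFinrankEq ℝ (commonKer θ) hd
  let p : V →ₗ[ℝ] commonKer θ :=
    (LinearMap.id - ∑ a, (θ a).smulRight (D a)).codRestrict (commonKer θ) (by
      intro v
      rw [mem_commonKer]
      intro a
      simp [LinearMap.sum_apply, hD])
  let w : Fin d → V := fun j => b j
  have hw : ∀ a j, θ a (w j) = 0 := fun a j => mem_commonKer.1 (b j).2 a
  have hp : ∀ j, p (w j) = b j := by
    intro j
    ext
    simp [p, LinearMap.sum_apply, hw]
    rfl
  -- Here `p` projects onto the common kernel along the span of `D`. The scalar makes both sides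
  -- agree on the spanning family `(D, w)`, which suffices for top forms.
  let ε : V [⋀^Fin d]→ₗ[ℝ] ℝ := μ (Fin.append D w) • (b.det).compLinearMap p
  refine ⟨ε, ?_⟩
  have hε : ε w = μ (Fin.append D w) := by
    have : (fun j => p (w j)) = b := funext hp
    simp only [ε, AlternatingMap.smul_apply, AlternatingMap.compLinearMap_apply]
    rw [this, Module.Basis.det_self]
    simp
  rw [← sub_eq_zero]
  apply top_form_eq_zero hN _ (Fin.append D w)
  · apply span_append_eq_top θ D w hD
    intro v hv
    have h1 := b.mem_span ⟨v, mem_commonKer.2 hv⟩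
    have h2 := Submodule.mem_map_of_mem (f := (commonKer θ).subtype) h1
    rw [Submodule.map_span, ← Set.range_comp] at h2
    exact h2
  · rw [AlternatingMap.sub_apply, ← hε, sub_eq_zero]
    exact wedge_wedgeOneForms_append θ ε D w hD hw

variable {m d N : ℕ} {e : m + d = N} {μ : V [⋀^Fin N]→ₗ[ℝ] ℝ}

omit [FiniteDimensional ℝ V] in
lemma IsFormQuotient.eq_on {θ : Fin m → V →ₗ[ℝ] ℝ} {D : Fin m → V}
    (hD : ∀ a b, θ a (D b) = if a = b then 1 else 0) {ε ε' : V [⋀^Fin d]→ₗ[ℝ] ℝ}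
    (h : IsFormQuotient e θ μ ε) (h' : IsFormQuotient e θ μ ε') {w : Fin d → V}
    (hw : ∀ a j, θ a (w j) = 0) : ε w = ε' w := by
  rw [h D w hD hw, h' D w hD hw]

/-- Transport of the interior product along a linear map `F` which matches the constraints `θ`
and the linear form `ℓ`, on vectors annihilated by all of them. -/
lemma IsFormQuotient.interior_map (hN : Module.finrank ℝ V = N) {θx θy : Fin m → V →ₗ[ℝ] ℝ}
    {D : Fin m → V} (hD : ∀ a b, θx a (D b) = if a = b then 1 else 0)
    {F : V →ₗ[ℝ] V} (hF : LinearMap.det F = -1) (hθ : ∀ a v, θy a (F v) = θx a v)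
    {ℓ : V →ₗ[ℝ] ℝ} (hℓ : ∀ v, ℓ (F v) = ℓ v) {X Y : V} (hX : ∀ a, θx a X = 0)
    (hY : ∀ a, θy a Y = 0) (hℓX : ℓ X ≠ 0) {j : ℝ} (hj : j * ℓ X = - ℓ Y)
    {εx εy : V [⋀^Fin d]→ₗ[ℝ] ℝ} (hεx : IsFormQuotient e θx μ εx) (hεy : IsFormQuotient e θy μ εy)
    (v : Fin (d - 1) → V) (hv : ∀ a i, θx a (v i) = 0) (hvℓ : ∀ i, ℓ (v i) = 0) :
    interior εy Y (fun i => F (v i)) = j * interior εx X v := by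
  revert v
  cases d with
  -- The interior product of a 0-form is zero by convention, so both sides vanish.
  | zero => simp [interior]
  | succ d =>
    intro (v : Fin d → V) (hv : ∀ a (i : Fin d), θx a (v i) = 0) (hvℓ : ∀ i : Fin d, ℓ (v i) = 0)
    change εy (Matrix.vecCons Y fun i => F (v i)) = j * εx (Matrix.vecCons X v)
    have hDy : ∀ a b, θy a ((F ∘ D) b) = if a = b then 1 else 0 := fun a b => by
      rw [Function.comp_apply, hθ, hD]
    have hcons : ∀ Z : V, (∀ a, θy a Z = 0) → ∀ a i,
        θy a (Matrix.vecCons Z (fun i => F (v i)) i) = 0 := by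
      intro Z hZ a i
      refine Fin.cases ?_ (fun i => ?_) i
      · exact hZ a
      · simpa [hθ] using hv a i
    have hXF : ∀ a, θy a (F X) = 0 := fun a => by rw [hθ, hX]
    -- By the choice of `j`, the vector `Y + j • F X` lies in the kernel of `ℓ`. All d + 1 vectors
    -- then lie in a proper subspace of the (d + 1)-dimensional common kernel and are dependent.
    have hZ : εy (Matrix.vecCons (Y + j • F X) fun i => F (v i)) = 0 := by
      apply AlternatingMap.map_linearDependent
      intro hli
      let K : Submodule ℝ V := commonKer θy ⊓ LinearMap.ker ℓ
      have hmem : ∀ i, Matrix.vecCons (Y + j • F X) (fun i => F (v i)) i ∈ K := by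
        intro i
        refine ⟨mem_commonKer.2 fun a => hcons _ (fun a => by simp [hY, hXF]) a i, ?_⟩
        refine Fin.cases ?_ (fun i => ?_) i
        · simp [hℓ, hj]
        · simpa [hℓ] using hvℓ i
      have hlt : K < commonKer θy := by
        refine lt_of_le_of_ne inf_le_left fun h => hℓX ?_
        have : F X ∈ K := by
          rw [h]
          exact mem_commonKer.2 hXF
        rw [← hℓ]
        exact this.2
      have h1 := Submodule.finrank_lt_finrank_of_lt hlt
      have h2 := finrank_commonKer θy _ hDy
      have hli' : LinearIndependent ℝ (fun i => (⟨_, hmem i⟩ : K)) :=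
        LinearIndependent.of_comp K.subtype hli
      have h3 := hli'.fintype_card_le_finrank
      simp only [Fintype.card_fin] at h3
      omega
    -- The vectors `F ∘ D` are dual to `θy`, so both sides are values of `μ` on a family and on its
    -- image under `F`; the sign is det F.
    have hFX : εy (Matrix.vecCons (F X) fun i => F (v i)) = - εx (Matrix.vecCons X v) := by
      rw [hεy (F ∘ D) _ hDy (hcons _ hXF), hεx D _ hD]
      · rw [← neg_one_mul, ← hF, ← top_form_comp hN]
        congr 1
        ext k
        simp only [Function.comp_apply]
        refine Fin.addCases (fun i => ?_) (fun i => ?_) (Fin.cast e.symm k)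
        · simp
        · rw [Fin.append_right, Fin.append_right]
          refine Fin.cases ?_ (fun i => ?_) i <;> simp
      · intro a i
        refine Fin.cases ?_ (fun i => ?_) i
        · exact hX a
        · simpa using hv a i
    have hadd : εy (Matrix.vecCons (Y + j • F X) fun i => F (v i)) =
        εy (Matrix.vecCons Y fun i => F (v i)) + j * εy (Matrix.vecCons (F X) fun i => F (v i)) := by
      rw [AlternatingMap.map_vecCons_add, AlternatingMap.map_vecCons_smul, smul_eq_mul]
    rw [hadd, hFX] at hZ
    linarith

/-- Inserting a vector transverse to `ℓ` gives a form that does not vanish on the common kernel of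
`θ` and `ℓ`. -/
lemma IsFormQuotient.exists_interior_ne_zero (hN : Module.finrank ℝ V = N) (hμ : μ ≠ 0)
    {θ : Fin m → V →ₗ[ℝ] ℝ} {D : Fin m → V} (hD : ∀ a b, θ a (D b) = if a = b then 1 else 0)
    {ℓ : V →ₗ[ℝ] ℝ} {X : V} (hX : ∀ a, θ a X = 0) (hℓX : ℓ X ≠ 0)
    {ε : V [⋀^Fin d]→ₗ[ℝ] ℝ} (hε : IsFormQuotient e θ μ ε) :
    ∃ v : Fin (d - 1) → V, (∀ a i, θ a (v i) = 0) ∧ (∀ i, ℓ (v i) = 0) ∧ interior ε X v ≠ 0 := by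
  have h2 := finrank_commonKer θ D hD
  have hd : Module.finrank ℝ (commonKer θ) = d := by omega
  let ℓ' : commonKer θ →ₗ[ℝ] ℝ := ℓ.comp (commonKer θ).subtype
  have hℓ' : LinearMap.range ℓ' = ⊤ := by
    rw [LinearMap.range_eq_top]
    intro c
    refine ⟨(c / ℓ X) • ⟨X, mem_commonKer.2 hX⟩, ?_⟩
    simp [ℓ', hℓX]
  have h3 := LinearMap.finrank_range_add_finrank_ker ℓ'
  rw [hℓ', hd] at h3
  simp only [finrank_top, Module.finrank_self] at h3
  -- The common kernel contains `X`, on which `ℓ` is nonzero, so its dimension is positive.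
  obtain ⟨d, rfl⟩ : ∃ d', d = d' + 1 := ⟨d - 1, by omega⟩
  let b := Module.finBasisOfFinrankEq ℝ (LinearMap.ker ℓ') (n := d) (by omega)
  let w : Fin d → V := fun i => ((b i : commonKer θ) : V)
  have hwθ : ∀ a i, θ a (w i) = 0 := fun a i => mem_commonKer.1 (b i : commonKer θ).2 a
  have hwℓ : ∀ i, ℓ (w i) = 0 := fun i => LinearMap.mem_ker.1 (b i).2
  refine ⟨w, hwθ, hwℓ, fun h => hμ ?_⟩
  change ε (Matrix.vecCons X w) = 0 at h
  subst e
  rw [hε D _ hD] at h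
  -- A basis of the kernel of `ℓ'` together with `X` spans the common kernel, and `D` supplies the
  -- rest of the space.
  · refine top_form_eq_zero hN μ _ (span_append_eq_top θ D (Matrix.vecCons X w) hD ?_) h
    intro v hv
    have hk : (⟨v - (ℓ v / ℓ X) • X, mem_commonKer.2 fun a => by simp [hv, hX]⟩ : commonKer θ) ∈
        LinearMap.ker ℓ' := by
      simp [ℓ', hℓX]
    have h4 := b.mem_span ⟨_, hk⟩
    have h5 := Submodule.mem_map_of_mem
      (f := (commonKer θ).subtype.comp (LinearMap.ker ℓ').subtype) h4
    rw [Submodule.map_span, ← Set.range_comp] at h5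
    have h6 : v - (ℓ v / ℓ X) • X ∈ Submodule.span ℝ (Set.range w) := h5
    have hr : Set.range w ⊆ Set.range (Matrix.vecCons X w) := by
      rintro _ ⟨i, rfl⟩
      exact ⟨i.succ, by simp⟩
    have h7 : X ∈ Submodule.span ℝ (Set.range (Matrix.vecCons X w)) :=
      Submodule.subset_span ⟨0, by simp⟩
    simpa using add_mem (Submodule.span_mono hr h6) (Submodule.smul_mem _ (ℓ v / ℓ X) h7)
  · intro a i
    refine Fin.cases ?_ (fun i => ?_) i
    · exact hX a
    · simpa using hwθ a i

end Quotient

end NHImpact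
end

/-! ### Tangent directions of a subset of a manifold and derivatives within it. -/

noncomputable section

namespace NHImpact

section Tangent

variable {F : Type*} [NormedAddCommGroup F] [NormedSpace ℝ F]
  {H : Type*} [TopologicalSpace H] {I : ModelWithCorners ℝ F H}
  {M : Type*} [TopologicalSpace M] [ChartedSpace H M]
  {G : Type*} [NormedAddCommGroup G] [NormedSpace ℝ G]

/-- The chart at a point has derivative the identity there. -/
lemma mfderiv_extChartAt_self [IsManifold I 1 M] (x : M) :
    (mfderiv I 𝓘(ℝ, F) (extChartAt I x) x : F →L[ℝ] F) = ContinuousLinearMap.id ℝ F := by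
  have hmd : MDifferentiableAt I 𝓘(ℝ, F) (extChartAt I x) x :=
    mdifferentiableAt_extChartAt (mem_chart_source H x)
  rw [hmd.mfderiv]
  have h : writtenInExtChartAt I 𝓘(ℝ, F) x (extChartAt I x) =ᶠ[𝓝[Set.range I] (extChartAt I x x)]
      id := by
    filter_upwards [extChartAt_target_mem_nhdsWithin (I := I) x] with y hy
    simp only [writtenInExtChartAt, extChartAt_model_space_eq_id, PartialEquiv.refl_coe,
      Function.comp_apply, id, (extChartAt I x).right_inv hy]
  rw [h.fderivWithin_eq (by
    simp only [writtenInExtChartAt, extChartAt_model_space_eq_id, PartialEquiv.refl_coe,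
      Function.comp_apply, id, (extChartAt I x).left_inv (mem_extChartAt_source x)])]
  exact fderivWithin_id (I.uniqueDiffOn _ (Set.mem_range_self _))

lemma mem_tangentDirections [IsManifold I 1 M] {S : Set M} {x : M} {v : TangentSpace I x} :
    v ∈ tangentDirections I S x ↔ v ∈
      tangentConeAt (E := F) ℝ ((extChartAt I x).target ∩ (extChartAt I x).symm ⁻¹' S) (extChartAt I x x) := by
  have h : mfderiv I 𝓘(ℝ, F) (extChartAt I x) x v = v :=
    congrArg (fun L : F →L[ℝ] F => L v) (mfderiv_extChartAt_self (I := I) x)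
  unfold tangentDirections
  rw [Set.mem_ofPred_eq, h]
  exact Iff.rfl

/-- The set on the right is the one in which derivatives within `S` are taken, so uniqueness of
derivatives on tangent cones becomes available. -/
lemma tangentDirections_subset [IsManifold I 1 M] {S : Set M} {x : M} {v : TangentSpace I x}
    (hv : v ∈ tangentDirections I S x) : v ∈
      tangentConeAt (E := F) ℝ ((extChartAt I x).symm ⁻¹' S ∩ Set.range I) (extChartAt I x x) :=
  tangentConeAt_mono (E := F)
    (s := (extChartAt I x).target ∩ (extChartAt I x).symm ⁻¹' S)
    (Set.subset_inter Set.inter_subset_right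
      (Set.inter_subset_left.trans (extChartAt_target_subset_range x)))
    (mem_tangentDirections.1 hv)

variable {F' : Type*} [NormedAddCommGroup F'] [NormedSpace ℝ F']
  {H' : Type*} [TopologicalSpace H'] {I' : ModelWithCorners ℝ F' H'}
  {M' : Type*} [TopologicalSpace M'] [ChartedSpace H' M']

/-- On a hypersurface a derivative within the set is not unique as a linear map; its values on
tangent directions are. -/
lemma HasMFDerivWithinAt.eq_on_tangentDirections [IsManifold I 1 M] {S : Set M} {x : M}
    {f : M → M'} {L L' : TangentSpace I x →L[ℝ] TangentSpace I' (f x)}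
    (h : HasMFDerivWithinAt I I' f S x L) (h' : HasMFDerivWithinAt I I' f S x L')
    {v : TangentSpace I x} (hv : v ∈ tangentDirections I S x) : L v = L' v := by
  have key : ∀ {g : F → F'} {K K' : F →L[ℝ] F'} {A : Set F} {a w : F},
      HasFDerivWithinAt g K A a → HasFDerivWithinAt g K' A a → w ∈ tangentConeAt ℝ A a →
        K w = K' w := fun h1 h2 hw => h1.unique_on h2 hw
  exact key h.2 h'.2 (tangentDirections_subset hv)

/-- Within `S` the function is constant, so zero is another of its derivatives there. -/
lemma mfderiv_eq_zero_of_mem_tangentDirections [IsManifold I 1 M] {S : Set M} {x : M} (hx : x ∈ S)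
    {f : M → G} (hf : MDifferentiableAt I 𝓘(ℝ, G) f x) {c : G} (hc : ∀ y ∈ S, f y = c)
    {v : TangentSpace I x} (hv : v ∈ tangentDirections I S x) :
    mfderiv I 𝓘(ℝ, G) f x v = 0 := by
  have h0 : HasMFDerivWithinAt I 𝓘(ℝ, G) f S x (0 : TangentSpace I x →L[ℝ] G) :=
    (hasMFDerivWithinAt_const c S x).congr_of_eventuallyEq
      (Filter.eventually_of_mem self_mem_nhdsWithin hc) (hc x hx)
  exact HasMFDerivWithinAt.eq_on_tangentDirections hf.hasMFDerivAt.hasMFDerivWithinAt h0 hv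

/-- The implicit function theorem yields a curve in the level set through `a` with velocity `v`; its
difference quotients exhibit `v` in the tangent cone. -/
lemma mem_tangentConeAt_of_hasStrictFDerivAt [CompleteSpace F] [FiniteDimensional ℝ G]
    {g : F → G} {g' : F →L[ℝ] G} {a : F} (hg : HasStrictFDerivAt g g' a) (hs : g'.range = ⊤)
    {S : Set F} (hS : ∀ᶠ y in 𝓝 a, g y = g a → y ∈ S) {v : F} (hv : g' v = 0) :
    v ∈ tangentConeAt ℝ S a := by
  have : CompleteSpace G := FiniteDimensional.complete ℝ G
  let φ := hg.implicitFunction g g' hs (g a)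
  have hφ : HasStrictFDerivAt φ g'.ker.subtypeL 0 := hg.to_implicitFunction hs
  let γ : ℝ → F := fun t => φ (t • (⟨v, hv⟩ : g'.ker))
  have hφ0 : φ 0 = a := by
    simp [φ]
  have hγ0 : γ 0 = a := by simp [γ, hφ0]
  have hlin : HasDerivAt (fun t : ℝ => t • (⟨v, hv⟩ : g'.ker)) ⟨v, hv⟩ 0 := by
    simpa using (hasDerivAt_id (0 : ℝ)).smul_const (⟨v, hv⟩ : g'.ker)
  have hγ : HasDerivAt γ v 0 := by
    have h1 : HasFDerivAt φ g'.ker.subtypeL ((fun t : ℝ => t • (⟨v, hv⟩ : g'.ker)) 0) := by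
      simpa using hφ.hasFDerivAt
    exact h1.comp_hasDerivAt (0 : ℝ) hlin
  have htend : Filter.Tendsto (fun t : ℝ => (g a, t • (⟨v, hv⟩ : g'.ker))) (𝓝 0)
      (𝓝 (g a, 0)) := by
    refine Filter.Tendsto.prodMk_nhds tendsto_const_nhds ?_
    simpa using hlin.continuousAt.tendsto
  have hlevel : ∀ᶠ t in 𝓝 (0 : ℝ), g (γ t) = g a :=
    htend.eventually (hg.map_implicitFunction_eq hs)
  have hcont : Filter.Tendsto γ (𝓝 0) (𝓝 a) := by
    simpa [hγ0] using hγ.continuousAt.tendsto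
  have hle : 𝓝[≠] (0 : ℝ) ≤ 𝓝 0 := nhdsWithin_le_nhds
  refine mem_tangentConeAt_of_seq (𝓝[≠] (0 : ℝ)) (fun t => t⁻¹) (fun t => γ t - a) ?_ ?_ ?_
  · simpa using (hcont.sub_const a).mono_left hle
  · filter_upwards [hle hlevel, hle (hcont.eventually hS)] with t h1 h2
    simpa using h2 h1
  · simpa [hγ0] using hγ.tendsto_slope_zero

lemma mem_tangentDirections_of_submersion [I.Boundaryless] [IsManifold I 1 M] [CompleteSpace F]
    [FiniteDimensional ℝ G] {S : Set M} {x : M} {f : M → G} (hf : ContMDiffAt I 𝓘(ℝ, G) 1 f x)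
    (hs : Function.Surjective (mfderiv I 𝓘(ℝ, G) f x)) (hS : ∀ᶠ y in 𝓝 x, f y = f x → y ∈ S)
    {v : TangentSpace I x} (hv : mfderiv I 𝓘(ℝ, G) f x v = 0) : v ∈ tangentDirections I S x := by
  rw [mem_tangentDirections]
  have hcd : ContDiffAt ℝ 1 (writtenInExtChartAt I 𝓘(ℝ, G) x f) (extChartAt I x x) := by
    have := (contMDiffAt_iff.1 hf).2
    rwa [I.range_eq_univ, contDiffWithinAt_univ] at this
  have hd : fderiv ℝ (writtenInExtChartAt I 𝓘(ℝ, G) x f) (extChartAt I x x) =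
      (mfderiv I 𝓘(ℝ, G) f x : F →L[ℝ] G) := by
    rw [(hf.mdifferentiableAt one_ne_zero).mfderiv, I.range_eq_univ, fderivWithin_univ]
  have hstrict := hcd.hasStrictFDerivAt one_ne_zero
  rw [hd] at hstrict
  refine mem_tangentConeAt_of_hasStrictFDerivAt hstrict (LinearMap.range_eq_top.2 hs) ?_ hv
  have hc : Filter.Tendsto (extChartAt I x).symm (𝓝 (extChartAt I x x)) (𝓝 x) := by
    simpa using (continuousAt_extChartAt_symm (I := I) x).tendsto
  filter_upwards [hc.eventually hS, extChartAt_target_mem_nhds (I := I) x] with y hy ht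
  intro h
  refine ⟨ht, hy ?_⟩
  simpa only [writtenInExtChartAt, extChartAt_model_space_eq_id, PartialEquiv.refl_coe,
      Function.comp_apply, id, (extChartAt I x).left_inv (mem_extChartAt_source x)] using h

end Tangent

end NHImpact
end

/-! ### Smoothness of bundle maps and of sections. -/

noncomputable section

namespace NHImpact

section BundleSmoothness

open Bundle

variable {B F₁ F₂ M : Type*} {n : WithTop ℕ∞}
  {E₁ : B → Type*} {E₂ : B → Type*}
  [∀ x, AddCommGroup (E₁ x)] [∀ x, Module ℝ (E₁ x)] [NormedAddCommGroup F₁] [NormedSpace ℝ F₁]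
  [TopologicalSpace (TotalSpace F₁ E₁)] [∀ x, TopologicalSpace (E₁ x)] [∀ x, AddCommGroup (E₂ x)]
  [∀ x, Module ℝ (E₂ x)] [NormedAddCommGroup F₂] [NormedSpace ℝ F₂]
  [TopologicalSpace (TotalSpace F₂ E₂)] [∀ x, TopologicalSpace (E₂ x)]
  {EB : Type*} [NormedAddCommGroup EB] [NormedSpace ℝ EB] {HB : Type*} [TopologicalSpace HB]
  {IB : ModelWithCorners ℝ EB HB} [TopologicalSpace B] [ChartedSpace HB B]
  {EM : Type*} [NormedAddCommGroup EM] [NormedSpace ℝ EM] {HM : Type*} [TopologicalSpace HM]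
  {IM : ModelWithCorners ℝ EM HM} [TopologicalSpace M] [ChartedSpace HM M]
  [FiberBundle F₁ E₁] [VectorBundle ℝ F₁ E₁] [FiberBundle F₂ E₂] [VectorBundle ℝ F₂ E₂]

/-- A linear combination of smooth maps to a vector bundle over the same base map is smooth. -/
lemma contMDiffAt_add_smul_bundle {b : M → B} {α β : ∀ x, E₁ (b x)} {f : M → ℝ} {x : M}
    (hα : ContMDiffAt IM (IB.prod 𝓘(ℝ, F₁)) n (fun m => TotalSpace.mk' F₁ (b m) (α m)) x)
    (hβ : ContMDiffAt IM (IB.prod 𝓘(ℝ, F₁)) n (fun m => TotalSpace.mk' F₁ (b m) (β m)) x)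
    (hf : ContMDiffAt IM 𝓘(ℝ, ℝ) n f x) :
    ContMDiffAt IM (IB.prod 𝓘(ℝ, F₁)) n
      (fun m => TotalSpace.mk' F₁ (b m) (α m + f m • β m)) x := by
  rw [contMDiffAt_totalSpace] at hα hβ ⊢
  refine ⟨hα.1, (hα.2.add (hf.smul hβ.2)).congr_of_eventuallyEq ?_⟩
  have hb : ∀ᶠ m in 𝓝 x, b m ∈ (trivializationAt F₁ E₁ (b x)).baseSet :=
    hα.1.continuousAt ((trivializationAt F₁ E₁ (b x)).open_baseSet.mem_nhds
      (FiberBundle.mem_baseSet_trivializationAt' (b x)))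
  filter_upwards [hb] with m hm
  have hl := (trivializationAt F₁ E₁ (b x)).linear ℝ hm
  exact (hl.map_add _ _).trans (congrArg _ (hl.map_smul _ _))

lemma inverse_equiv_comp_comp {V₁ V₂ G₁ G₂ : Type*} [AddCommGroup V₁] [Module ℝ V₁]
    [TopologicalSpace V₁] [AddCommGroup V₂] [Module ℝ V₂] [TopologicalSpace V₂]
    [AddCommGroup G₁] [Module ℝ G₁] [TopologicalSpace G₁] [AddCommGroup G₂] [Module ℝ G₂]
    [TopologicalSpace G₂] (e₁ : V₁ ≃L[ℝ] G₁) (e₂ : V₂ ≃L[ℝ] G₂) (φ : V₁ →L[ℝ] V₂)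
    (h : φ.IsInvertible) :
    ((e₂ : V₂ →L[ℝ] G₂).comp (φ.comp (e₁.symm : G₁ →L[ℝ] V₁))).IsInvertible ∧
      ((e₂ : V₂ →L[ℝ] G₂).comp (φ.comp (e₁.symm : G₁ →L[ℝ] V₁))).inverse =
      (e₁ : V₁ →L[ℝ] G₁).comp (φ.inverse.comp (e₂.symm : G₂ →L[ℝ] V₂)) := by
  obtain ⟨φ, rfl⟩ := h
  have : (e₂ : V₂ →L[ℝ] G₂).comp ((φ : V₁ →L[ℝ] V₂).comp (e₁.symm : G₁ →L[ℝ] V₁)) =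
      ((e₁.symm.trans φ).trans e₂ : G₁ ≃L[ℝ] G₂) := rfl
  rw [this, ContinuousLinearMap.inverse_equiv, ContinuousLinearMap.inverse_equiv]
  exact ⟨⟨_, rfl⟩, rfl⟩

/-- The fiberwise inverse of a smooth invertible bundle homomorphism is smooth. -/
lemma contMDiff_inverse_section [CompleteSpace F₁]
    [∀ x, IsTopologicalAddGroup (E₁ x)] [∀ x, ContinuousSMul ℝ (E₁ x)]
    [∀ x, IsTopologicalAddGroup (E₂ x)] [∀ x, ContinuousSMul ℝ (E₂ x)]
    {φ : ∀ b, E₁ b →L[ℝ] E₂ b} (hinv : ∀ b, (φ b).IsInvertible)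
    (hφ : ContMDiff IB (IB.prod 𝓘(ℝ, F₁ →L[ℝ] F₂)) n
      (fun b => TotalSpace.mk' (F₁ →L[ℝ] F₂) (E := fun x => E₁ x →L[ℝ] E₂ x) b (φ b))) :
    ContMDiff IB (IB.prod 𝓘(ℝ, F₂ →L[ℝ] F₁)) n
      (fun b => TotalSpace.mk' (F₂ →L[ℝ] F₁) (E := fun x => E₂ x →L[ℝ] E₁ x) b (φ b).inverse) := by
  intro x
  have h := hφ x
  rw [contMDiffAt_hom_bundle] at h ⊢
  refine ⟨h.1, ?_⟩
  have h1 : ∀ᶠ m in 𝓝 x, m ∈ (trivializationAt F₁ E₁ x).baseSet :=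
    (trivializationAt F₁ E₁ x).open_baseSet.mem_nhds (FiberBundle.mem_baseSet_trivializationAt' x)
  have h2 : ∀ᶠ m in 𝓝 x, m ∈ (trivializationAt F₂ E₂ x).baseSet :=
    (trivializationAt F₂ E₂ x).open_baseSet.mem_nhds (FiberBundle.mem_baseSet_trivializationAt' x)
  -- In trivializations the fiberwise inverse is the inverse of the coordinate expression, and
  -- inversion is smooth near an invertible operator.
  have key : ∀ m ∈ (trivializationAt F₁ E₁ x).baseSet, m ∈ (trivializationAt F₂ E₂ x).baseSet →
      (ContinuousLinearMap.inCoordinates F₁ E₁ F₂ E₂ x m x m (φ m)).IsInvertible ∧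
      (ContinuousLinearMap.inCoordinates F₁ E₁ F₂ E₂ x m x m (φ m)).inverse =
        ContinuousLinearMap.inCoordinates F₂ E₂ F₁ E₁ x m x m (φ m).inverse := by
    intro m hm1 hm2
    rw [ContinuousLinearMap.inCoordinates_eq hm1 hm2, ContinuousLinearMap.inCoordinates_eq hm2 hm1]
    exact inverse_equiv_comp_comp _ _ _ (hinv m)
  have hx := (key x h1.self_of_nhds h2.self_of_nhds).1
  refine (ContMDiffAt.comp x (hx.contDiffAt_map_inverse (n := n)).contMDiffAt h.2)
    |>.congr_of_eventuallyEq ?_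
  filter_upwards [h1, h2] with m hm1 hm2
  exact (key m hm1 hm2).2.symm

end BundleSmoothness

section CotangentBundle

open Bundle

variable {E : Type*} [NormedAddCommGroup E] [NormedSpace ℝ E]
variable {Q : Type*} [TopologicalSpace Q] [ChartedSpace E Q] [IsManifold 𝓘(ℝ, E) ∞ Q]
  {EM : Type*} [NormedAddCommGroup EM] [NormedSpace ℝ EM] {HM : Type*} [TopologicalSpace HM]
  {IM : ModelWithCorners ℝ EM HM} {M : Type*} [TopologicalSpace M] [ChartedSpace HM M]

/-- The evaluation of a smooth covector field on a smooth vector field, both along a map to the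
base, is smooth. -/
lemma contMDiffAt_pairing {b : M → Q} {α : ∀ x, CotangentSpace (E := E) Q (b x)}
    {w : ∀ x, TangentSpace 𝓘(ℝ, E) (b x)} {x : M}
    (hα : ContMDiffAt IM (modelT E) ∞ (fun m => (⟨b m, α m⟩ : CotangentBundle (E := E) Q)) x)
    (hw : ContMDiffAt IM (𝓘(ℝ, E).prod 𝓘(ℝ, E)) ∞
      (fun m => TotalSpace.mk' E (E := TangentSpace 𝓘(ℝ, E)) (b m) (w m)) x) :
    ContMDiffAt IM 𝓘(ℝ, ℝ) ∞ (fun m => (α m (w m) : ℝ)) x := by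
  have h := ContMDiffAt.clm_bundle_apply (F₁ := E) (F₂ := ℝ)
    (E₁ := fun q : Q => TangentSpace 𝓘(ℝ, E) q) (E₂ := Bundle.Trivial Q ℝ) hα hw
  rw [contMDiffAt_totalSpace] at h
  exact h.2

/-- The differential of a smooth function is a smooth section of the cotangent bundle. -/
lemma contMDiff_mfderiv_section {f : Q → ℝ} (hf : ContMDiff 𝓘(ℝ, E) 𝓘(ℝ, ℝ) ∞ f) :
    ContMDiff 𝓘(ℝ, E) (modelT E) ∞
      (fun q => (⟨q, mfderiv 𝓘(ℝ, E) 𝓘(ℝ, ℝ) f q⟩ : CotangentBundle (E := E) Q)) := by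
  intro x
  have h := (hf x).mfderiv_const (m := ∞) (by simp)
  rw [contMDiffAt_hom_bundle]
  refine ⟨contMDiffAt_id, h.congr_of_eventuallyEq (Filter.Eventually.of_forall fun q => ?_)⟩
  ext v
  simp [ContinuousLinearMap.inCoordinates, inTangentCoordinates]
  rfl

/-- The trivialization at `q` is the identity on the fiber over `q`. -/
lemma trivializationAt_cotangent_self (q : Q) (p : CotangentSpace (E := E) Q q) :
    (trivializationAt (E →L[ℝ] ℝ) (fun q : Q => CotangentSpace (E := E) Q q) q ⟨q, p⟩).2 = p := by
  rw [hom_trivializationAt_apply]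
  ext v
  have h : (trivializationAt E (TangentSpace 𝓘(ℝ, E)) q).symmL ℝ q v = v := by
    rw [TangentBundle.symmL_trivializationAt_eq_core (mem_chart_source E q)]
    exact (tangentBundleCore 𝓘(ℝ, E) Q).coordChange_self (achart E q) q (mem_chart_source E q) v
  simp [ContinuousLinearMap.inCoordinates]
  exact congrArg p h

end CotangentBundle

end NHImpact
end

/-! ### The symplectic form, the projection and vertical curves in bundle coordinates. -/

noncomputable section

namespace NHImpact

section CotangentGeometry

open Bundle

variable {E : Type*} [NormedAddCommGroup E] [NormedSpace ℝ E]
variable {Q : Type*} [TopologicalSpace Q] [ChartedSpace E Q] [IsManifold 𝓘(ℝ, E) ∞ Q]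

lemma chartTangent_apply (x : CotangentBundle (E := E) Q) (v : TangentSpace (modelT E) x) :
    chartTangent x v = v :=
  congrArg (fun L : (E × (E →L[ℝ] ℝ)) →L[ℝ] (E × (E →L[ℝ] ℝ)) => L v)
    (mfderiv_extChartAt_self (I := modelT E) x)

/-- The chart at `x` has identity derivative at `x`, so in the model space the form is the same at
every point. This is what lets volume forms at `x` and at Δ(x) be compared. -/
lemma symplecticForm_eq (x : CotangentBundle (E := E) Q) :
    symplecticForm x = canonicalTwoForm E := by
  ext v
  have h : (fun i => chartTangent x (v i)) = v := funext fun i => chartTangent_apply x (v i)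
  exact congrArg (canonicalTwoForm E) h

lemma symplecticForm_apply (x : CotangentBundle (E := E) Q) (u v : E × (E →L[ℝ] ℝ)) :
    symplecticForm x ![u, v] = v.2 u.1 - u.2 v.1 := by
  rw [symplecticForm_eq]
  rfl

lemma symplecticForm_swap (x : CotangentBundle (E := E) Q) (u v : TangentSpace (modelT E) x) :
    symplecticForm x ![u, v] = - symplecticForm x ![v, u] := by
  refine (symplecticForm_apply x u v).trans ?_
  refine Eq.trans ?_ (congrArg Neg.neg (symplecticForm_apply x v u)).symm
  ring

lemma exists_canonical_dual [FiniteDimensional ℝ E] (ν : E × (E →L[ℝ] ℝ) →ₗ[ℝ] ℝ) :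
    ∃ X : E × (E →L[ℝ] ℝ), ∀ v : E × (E →L[ℝ] ℝ), v.2 X.1 - X.2 v.1 = ν v := by
  let b := Module.finBasis ℝ E
  let c : Fin (Module.finrank ℝ E) → (E →L[ℝ] ℝ) := fun i =>
    LinearMap.toContinuousLinearMap (b.coord i)
  -- Hamilton's equations: the base part is the derivative of `ν` along momenta, the fiber part
  -- minus its restriction to positions.
  refine ⟨(∑ i, ν (0, c i) • b i,
    - LinearMap.toContinuousLinearMap (ν.comp (LinearMap.inl ℝ E (E →L[ℝ] ℝ)))), fun v => ?_⟩
  have hv : v = (v.1, 0) + ∑ i, v.2 (b i) • ((0 : E), c i) := by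
    have h2 : ∑ i, v.2 (b i) • c i = v.2 := by
      ext w
      have h3 := congrArg v.2 (b.sum_repr w)
      rw [map_sum] at h3
      rw [← h3]
      simp [c, mul_comm]
    ext1
    · simp [Prod.fst_sum]
    · simp [Prod.snd_sum, h2]
  have hν : ν v = ν (v.1, 0) + ∑ i, v.2 (b i) * ν (0, c i) := by
    conv_lhs => rw [hv]
    rw [map_add, map_sum]
    simp_rw [map_smul, smul_eq_mul]
  rw [hν]
  simp [mul_comm, add_comm]

lemma symplecticDual_spec [FiniteDimensional ℝ E] (x : CotangentBundle (E := E) Q)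
    (ν : TangentSpace (modelT E) x →ₗ[ℝ] ℝ) (v : TangentSpace (modelT E) x) :
    symplecticForm x ![symplecticDual x ν, v] = ν v := by
  have h : ∃ X : TangentSpace (modelT E) x, ∀ v, symplecticForm x ![X, v] = ν v := by
    obtain ⟨X, hX⟩ := exists_canonical_dual (E := E) ν
    exact ⟨X, fun v => (symplecticForm_apply x X v).trans (hX v)⟩
  exact Classical.epsilon_spec h v

lemma liouville_ne_zero [FiniteDimensional ℝ E] (x : CotangentBundle (E := E) Q) :
    ImpactSystem.liouville x ≠ 0 := by
  intro h
  apply wedgePow_canonical_ne_zero E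
  rw [← symplecticForm_eq x]
  exact h

lemma liouville_eq [FiniteDimensional ℝ E] (x y : CotangentBundle (E := E) Q) :
    ImpactSystem.liouville x =
      (ImpactSystem.liouville y : (E × (E →L[ℝ] ℝ)) [⋀^Fin _]→ₗ[ℝ] ℝ) := by
  have h : ∀ z : CotangentBundle (E := E) Q, ImpactSystem.liouville z =
    wedgePow (canonicalTwoForm E) (Module.finrank ℝ E) := fun z =>
      congrArg (fun θ : (E × (E →L[ℝ] ℝ)) [⋀^Fin 2]→ₗ[ℝ] ℝ => wedgePow θ (Module.finrank ℝ E))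
        (symplecticForm_eq z)
  rw [h x, h y]

lemma finrank_model [FiniteDimensional ℝ E] :
    Module.finrank ℝ (E × (E →L[ℝ] ℝ)) = 2 * Module.finrank ℝ E := by
  have : Module.finrank ℝ (E →L[ℝ] ℝ) = Module.finrank ℝ E := by
    rw [← LinearEquiv.finrank_eq (LinearMap.toContinuousLinearMap : (E →ₗ[ℝ] ℝ) ≃ₗ[ℝ] (E →L[ℝ] ℝ))]
    exact Subspace.dual_finrank_eq
  rw [Module.finrank_prod, this]
  ring

lemma contMDiff_cotangent_proj :
    ContMDiff (modelT E) 𝓘(ℝ, E) ∞ (fun y : CotangentBundle (E := E) Q => y.proj) :=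
  contMDiff_proj _

/-- A bundle chart covers the chart of the base, so in it the projection is the first coordinate. -/
lemma mfderiv_proj_apply (x : CotangentBundle (E := E) Q) (v : E × (E →L[ℝ] ℝ)) :
    mfderiv (modelT E) 𝓘(ℝ, E) (fun y : CotangentBundle (E := E) Q => y.proj) x v = v.1 := by
  have hmd : MDifferentiableAt (modelT E) 𝓘(ℝ, E)
      (fun y : CotangentBundle (E := E) Q => y.proj) x :=
    contMDiff_cotangent_proj.contMDiffAt.mdifferentiableAt (by simp)
  have h : writtenInExtChartAt (modelT E) 𝓘(ℝ, E) x (fun y : CotangentBundle (E := E) Q => y.proj)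
      =ᶠ[𝓝 (extChartAt (modelT E) x x)] Prod.fst := by
    filter_upwards [extChartAt_target_mem_nhds (I := modelT E) x] with y hy
    have h1 := (extChartAt (modelT E) x).right_inv hy
    have h2 := (extChartAt (modelT E) x).map_target hy
    rw [FiberBundle.extChartAt] at h1 h2
    have h3 := congrArg Prod.fst h1
    simp only [writtenInExtChartAt, FiberBundle.extChartAt, Function.comp_apply]
    rw [← h3]
    simp only [PartialEquiv.trans_source, PartialEquiv.prod_source, PartialEquiv.refl_source,
      PartialEquiv.coe_trans, PartialEquiv.prod_coe, Function.comp_apply, PartialEquiv.refl_coe,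
      Set.mem_inter_iff, OpenPartialHomeomorph.coe_toPartialEquiv, Trivialization.coe_coe] at h2 ⊢
    rw [Trivialization.coe_fst _ h2.1]
  rw [hmd.mfderiv, (modelT E).range_eq_univ, fderivWithin_univ, h.fderiv_eq, fderiv_fst]
  rfl

/-- The momentum of a point of the cotangent bundle, as an element of the model fiber. -/
def fiberPart (x : CotangentBundle (E := E) Q) : E →L[ℝ] ℝ := x.2

/-- The vertical curve `t ↦ (q, p + t β)` in the cotangent bundle. -/
def verticalCurve (x : CotangentBundle (E := E) Q) (β : E →L[ℝ] ℝ) (t : ℝ) :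
    CotangentBundle (E := E) Q :=
  ⟨x.proj, fiberPart x + t • β⟩

omit [IsManifold 𝓘(ℝ, E) ∞ Q] in
lemma verticalCurve_zero (x : CotangentBundle (E := E) Q) (β : E →L[ℝ] ℝ) :
    verticalCurve x β 0 = x := by
  simp only [verticalCurve, zero_smul]
  exact congrArg (TotalSpace.mk x.proj) (add_zero (fiberPart x))

/-- The trivialization at the base point is the identity on the fiber over that point, so the curve
is a straight line in the chart. -/
lemma extChartAt_verticalCurve (x : CotangentBundle (E := E) Q) (β : E →L[ℝ] ℝ) (t : ℝ) :
    extChartAt (modelT E) x (verticalCurve x β t) =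
      (extChartAt 𝓘(ℝ, E) x.proj x.proj, fiberPart x + t • β) := by
  rw [FiberBundle.extChartAt]
  refine Prod.ext rfl ?_
  exact trivializationAt_cotangent_self x.proj _

lemma hasMFDerivAt_verticalCurve (x : CotangentBundle (E := E) Q) (β : E →L[ℝ] ℝ) :
    HasMFDerivAt 𝓘(ℝ, ℝ) (modelT E) (verticalCurve x β) 0
      ((ContinuousLinearMap.toSpanSingleton ℝ ((0, β) : E × (E →L[ℝ] ℝ)) :
        ℝ →L[ℝ] E × (E →L[ℝ] ℝ))) := by
  have hline : ContDiff ℝ ∞ fun t : ℝ => fiberPart x + t • β := by fun_prop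
  have hc : ContMDiffAt 𝓘(ℝ, ℝ) (modelT E) ∞ (verticalCurve x β) 0 := by
    rw [contMDiffAt_totalSpace]
    refine ⟨contMDiffAt_const, hline.contMDiff.contMDiffAt.congr_of_eventuallyEq
      (Filter.Eventually.of_forall fun t => ?_)⟩
    exact trivializationAt_cotangent_self x.proj _
  refine ⟨hc.continuousAt, ?_⟩
  have h : writtenInExtChartAt 𝓘(ℝ, ℝ) (modelT E) 0 (verticalCurve x β) =
      fun t : ℝ => (extChartAt 𝓘(ℝ, E) x.proj x.proj, fiberPart x + t • β) := by
    funext t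
    rw [← extChartAt_verticalCurve, writtenInExtChartAt, verticalCurve_zero]
    rfl
  rw [h]
  refine HasFDerivAt.hasFDerivWithinAt ?_
  have h1 : HasDerivAt (fun t : ℝ => (extChartAt 𝓘(ℝ, E) x.proj x.proj,
      fiberPart x + t • β)) ((0 : E), β) 0 := by
    refine (hasDerivAt_const _ _).prodMk ?_
    simpa using ((hasDerivAt_id (0 : ℝ)).smul_const β).const_add (fiberPart x)
  exact h1.hasFDerivAt

variable {F' : Type*} [NormedAddCommGroup F'] [NormedSpace ℝ F']

/-- The derivative of a function along the fibers of the cotangent bundle. -/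
lemma hasDerivAt_verticalCurve {f : CotangentBundle (E := E) Q → F'}
    {x : CotangentBundle (E := E) Q} (hf : MDifferentiableAt (modelT E) 𝓘(ℝ, F') f x)
    (β : E →L[ℝ] ℝ) :
    HasDerivAt (fun t => f (verticalCurve x β t))
      (mfderiv (modelT E) 𝓘(ℝ, F') f x ((0, β) : E × (E →L[ℝ] ℝ))) 0 := by
  have hf' : HasMFDerivAt (modelT E) 𝓘(ℝ, F') f (verticalCurve x β 0)
      (mfderiv (modelT E) 𝓘(ℝ, F') f x) := by
    rw [verticalCurve_zero]
    exact hf.hasMFDerivAt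
  have h : HasFDerivAt (fun t => f (verticalCurve x β t))
      ((mfderiv (modelT E) 𝓘(ℝ, F') f x : (E × (E →L[ℝ] ℝ)) →L[ℝ] F').comp
        (ContinuousLinearMap.toSpanSingleton ℝ ((0, β) : E × (E →L[ℝ] ℝ)))) 0 :=
    hasMFDerivAt_iff_hasFDerivAt.1 (hf'.comp (0 : ℝ) (hasMFDerivAt_verticalCurve x β))
  have key : ∀ {g : ℝ → F'} {L : (E × (E →L[ℝ] ℝ)) →L[ℝ] F'} {w : E × (E →L[ℝ] ℝ)},
      HasFDerivAt g (L.comp (ContinuousLinearMap.toSpanSingleton ℝ w)) 0 →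
        HasDerivAt g (L w) 0 := fun hg => hg.hasDerivAt.congr_deriv (by simp)
  exact key h

end CotangentGeometry

end NHImpact
end

/-! ### Linear algebra of the constraints and of the impact map. -/

noncomputable section

namespace NHImpact

lemma isInvertible_of_pos {E : Type*} [NormedAddCommGroup E] [NormedSpace ℝ E]
    [FiniteDimensional ℝ E] (G : E →L[ℝ] E →L[ℝ] ℝ) (hG : ∀ v, v ≠ 0 → 0 < G v v) :
    G.IsInvertible := by
  have hinj : Function.Injective (G : E →ₗ[ℝ] E →L[ℝ] ℝ) := by
    rw [← LinearMap.ker_eq_bot, LinearMap.ker_eq_bot']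
    intro v hv
    by_contra hne
    have h0 : G v = 0 := hv
    have := hG v hne
    rw [h0] at this
    simp at this
  have hdim : Module.finrank ℝ E = Module.finrank ℝ (E →L[ℝ] ℝ) := by
    rw [← LinearEquiv.finrank_eq (LinearMap.toContinuousLinearMap : (E →ₗ[ℝ] ℝ) ≃ₗ[ℝ] (E →L[ℝ] ℝ))]
    exact Subspace.dual_finrank_eq.symm
  refine ⟨(LinearEquiv.ofInjectiveOfFinrankEq (G : E →ₗ[ℝ] E →L[ℝ] ℝ) hinj
    hdim).toContinuousLinearEquiv, ?_⟩
  ext v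
  rfl

lemma sum_smul_apply {E : Type*} [NormedAddCommGroup E] [NormedSpace ℝ E] {m : ℕ}
    (c : Fin m → ℝ) (α : Fin m → E →L[ℝ] ℝ) (w : E) :
    (∑ a, c a • α a) w = ∑ a, c a * α a w := by
  simp [sum_apply]

namespace ImpactSystem

variable {E : Type*} [NormedAddCommGroup E] [NormedSpace ℝ E] [FiniteDimensional ℝ E]
variable {Q : Type*} [TopologicalSpace Q] [ChartedSpace E Q] [IsManifold 𝓘(ℝ, E) ∞ Q]
variable {m : ℕ} (s : ImpactSystem E Q m)

lemma flat_isInvertible (q : Q) : (s.flat q).IsInvertible :=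
  isInvertible_of_pos (E := E) (s.g.inner q) (s.g.pos q)

lemma inner_sharp (q : Q) (α : CotangentSpace (E := E) Q q) (w : TangentSpace 𝓘(ℝ, E) q) :
    s.g.inner q (s.sharp q α) w = α w := by
  have h : s.flat q (s.sharp q α) = α := (s.flat_isInvertible q).self_apply_inverse α
  exact congrArg (fun β : CotangentSpace (E := E) Q q => β w) h

lemma flat_sharp (q : Q) (α : CotangentSpace (E := E) Q q) : s.flat q (s.sharp q α) = α :=
  (s.flat_isInvertible q).self_apply_inverse α

/-- Symmetry of the cometric. It converts momenta such as P(Wᵃ) and P(∇h) into ηᵃ and dh applied to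
the velocity. -/
lemma apply_sharp_comm (q : Q) (α β : CotangentSpace (E := E) Q q) :
    α (s.sharp q β) = β (s.sharp q α) := by
  rw [← s.inner_sharp q α, ← s.inner_sharp q β]
  exact s.g.symm q _ _

lemma massMatrix_apply (q : Q) (a b : Fin m) : s.massMatrix q a b = s.η a q (s.W b q) :=
  s.inner_sharp q _ _

omit [FiniteDimensional ℝ E] in
lemma massMatrix_symm (q : Q) (a b : Fin m) : s.massMatrix q a b = s.massMatrix q b a :=
  s.g.symm q _ _

/-- This is a Gram matrix: a null vector `c` gives α = ∑ cₐ ηᵃ of zero length, hence α = 0, against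
independence. -/
lemma massMatrix_det_ne_zero (q : Q) : (s.massMatrix q).det ≠ 0 := by
  intro hdet
  obtain ⟨c, hc, hMc⟩ := Matrix.exists_mulVec_eq_zero_iff.2 hdet
  have hrow : ∀ a, ∑ b, s.η a q (s.W b q) * c b = 0 := by
    intro a
    have := congrFun hMc a
    simpa [Matrix.mulVec, dotProduct, massMatrix_apply] using this
  let α : CotangentSpace (E := E) Q q := ∑ a, c a • s.η a q
  have hpair : α (s.sharp q α) = 0 := by
    have h1 : s.sharp q α = ∑ b, c b • s.W b q := by
      simp only [α, map_sum, map_smul]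
      rfl
    rw [h1]
    have h2 : ∀ w, α w = ∑ a, c a * s.η a q w := by
      intro w
      exact sum_smul_apply (E := E) c (fun a => s.η a q) w
    rw [h2]
    refine Finset.sum_eq_zero fun a _ => ?_
    have h3 : s.η a q (∑ b, c b • s.W b q) = 0 := by
      rw [map_sum]
      simp_rw [map_smul]
      rw [← hrow a]
      exact Finset.sum_congr rfl fun b _ => mul_comm _ _
    rw [h3]
    exact mul_zero _
  have hα : α = 0 := by
    have h0 : s.sharp q α = 0 := by
      by_contra hne
      have := s.g.pos q _ hne
      rw [s.inner_sharp, hpair] at this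
      exact lt_irrefl _ this
    rw [← s.flat_sharp q α, h0, map_zero]
  exact hc (funext fun a => Fintype.linearIndependent_iff.1 (s.η_indep q) c hα a)

lemma sum_massMatrix_massInv (q : Q) (a b : Fin m) :
    ∑ c, s.massMatrix q a c * s.massInv q c b = if a = b then 1 else 0 := by
  have h : s.massMatrix q * s.massInv q = 1 :=
    Matrix.mul_nonsing_inv _ (isUnit_iff_ne_zero.2 (s.massMatrix_det_ne_zero q))
  have := congrFun (congrFun h a) b
  rwa [Matrix.mul_apply, Matrix.one_apply] at this

/-- The covector `π_𝒟^* dh = dh - m_{ab} dh(Wᵇ) ηᵃ`. -/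
def dhD (q : Q) : CotangentSpace (E := E) Q q :=
  s.dh q - ∑ a, (∑ b, s.massInv q a b * s.dh q (s.W b q) : ℝ) • s.η a q

/-- The component of `∇h` in `𝒟`. -/
def gradhD (q : Q) : TangentSpace 𝓘(ℝ, E) q := s.sharp q (s.dhD q)

omit [FiniteDimensional ℝ E] in
lemma dhD_apply (q : Q) (v : TangentSpace 𝓘(ℝ, E) q) :
    s.dhD q v = s.dh q v -
      ∑ a, ∑ b, s.massInv q a b * s.dh q (s.W b q) * s.η a q v := by
  change (s.dh q - ∑ a, (∑ b, s.massInv q a b * s.dh q (s.W b q) : ℝ) • s.η a q : E →L[ℝ] ℝ) v = _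
  rw [sub_apply, sum_apply]
  congr 1
  refine Finset.sum_congr rfl fun a _ => ?_
  rw [← Finset.sum_mul]
  rfl

omit [FiniteDimensional ℝ E] in
lemma dhD_eq_dh_projD (q : Q) (v : TangentSpace 𝓘(ℝ, E) q) :
    s.dhD q v = s.dh q (s.projD q v) := by
  rw [dhD_apply, projD, map_sub]
  congr 1
  simp_rw [map_sum, map_smul]
  refine Finset.sum_congr rfl fun a _ => Finset.sum_congr rfl fun b _ => ?_
  change _ = s.massInv q a b * s.η a q v * s.dh q (s.W b q)
  ring

omit [FiniteDimensional ℝ E] in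
lemma gradhD_eq (q : Q) : s.gradhD q =
    s.gradh q - ∑ a, (∑ b, s.massInv q a b * s.dh q (s.W b q) : ℝ) • s.W a q := by
  rw [gradhD, dhD, map_sub, map_sum]
  simp_rw [map_smul]
  rfl

/-- The correction subtracted from ∇h is its component in the span of the Wᵃ, found by inverting the
mass matrix. -/
lemma η_gradhD (q : Q) (a : Fin m) : s.η a q (s.gradhD q) = 0 := by
  rw [gradhD_eq, map_sub, map_sum]
  simp_rw [map_smul]
  have h1 : s.η a q (s.gradh q) = s.dh q (s.W a q) := s.apply_sharp_comm q _ _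
  have h2 : ∀ c, s.η a q (s.W c q) = s.massMatrix q a c := fun c => (s.massMatrix_apply q a c).symm
  simp_rw [h1, h2]
  change s.dh q (s.W a q) -
    ∑ c, (∑ b, s.massInv q c b * s.dh q (s.W b q)) * s.massMatrix q a c = (0 : ℝ)
  have h3 : ∑ c, (∑ b, s.massInv q c b * s.dh q (s.W b q)) * s.massMatrix q a c =
      ∑ b, (∑ c, s.massMatrix q a c * s.massInv q c b) * s.dh q (s.W b q) := by
    simp_rw [Finset.sum_mul]
    rw [Finset.sum_comm]
    exact Finset.sum_congr rfl fun b _ => Finset.sum_congr rfl fun c _ => by ring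
  rw [h3]
  simp [sum_massMatrix_massInv]

lemma dhD_W (q : Q) (a : Fin m) : s.dhD q (s.W a q) = 0 :=
  (s.apply_sharp_comm q _ _).trans (s.η_gradhD q a)

omit [FiniteDimensional ℝ E] in
lemma impactDenom_eq (q : Q) : s.impactDenom q = s.dh q (s.gradhD q) := by
  rw [gradhD_eq, map_sub, map_sum, impactDenom]
  simp_rw [map_smul]
  congr 1
  refine Finset.sum_congr rfl fun a _ => ?_
  change _ = (∑ b, s.massInv q a b * s.dh q (s.W b q)) * s.dh q (s.W a q)
  rw [Finset.sum_mul]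
  exact Finset.sum_congr rfl fun b _ => by ring

lemma dhD_gradhD (q : Q) : s.dhD q (s.gradhD q) = s.impactDenom q := by
  rw [dhD_apply, impactDenom_eq]
  simp [η_gradhD]

/-- The denominator is the squared length of `gradhD`. If it vanished, `dhD` would be zero; but
`dhD` agrees with dh on 𝒟, where dh is nonzero. -/
lemma impactDenom_ne_zero {q : Q} (hq : s.h q = 0) : s.impactDenom q ≠ 0 := by
  obtain ⟨v, hv, hne⟩ := s.nontrivial_impact q hq
  intro h0
  have hu : s.gradhD q = 0 := by
    by_contra hne'
    have := s.g.pos q _ hne'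
    rw [gradhD, s.inner_sharp] at this
    exact this.ne' ((s.dhD_gradhD q).trans h0)
  have hc : s.dhD q = 0 := by
    rw [← s.flat_sharp q (s.dhD q)]
    exact (congrArg _ hu).trans (map_zero _)
  apply hne
  have h1 := s.dhD_apply q v
  rw [hc] at h1
  simp only [hv, mul_zero, Finset.sum_const_zero, sub_zero] at h1
  exact h1.symm

omit [FiniteDimensional ℝ E] in
lemma epsC_eq (q : Q) (v : TangentSpace 𝓘(ℝ, E) q) :
    s.epsC q v = -2 * s.dhD q v / s.impactDenom q := by
  rw [epsC, dhD_apply]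
  congr 1
  ring

/-- The multiplier `lamC` is −`epsC` times the coefficient of Wᵏ in the normal part of ∇h, so the
total kick is along `gradhD` alone. No condition on `x` is needed: where the denominator is zero,
both forms divide by zero alike. -/
lemma impactC_eq (x : CotangentBundle (E := E) Q) :
    s.impactC x = ⟨x.proj, x.2 + (-2 * x.2 (s.gradhD x.proj) / s.impactDenom x.proj : ℝ) •
      s.dhD x.proj⟩ := by
  obtain ⟨q, p⟩ := x
  rw [impactC]
  dsimp only
  set v := s.sharp q p with hv
  have hp : p (s.gradhD q) = s.dhD q v := s.apply_sharp_comm q _ _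
  have h1 : ∑ k, s.lamC q v k • s.W k q = - (s.epsC q v •
      ∑ a, (∑ b, s.massInv q a b * s.dh q (s.W b q) : ℝ) • s.W a q) := by
    rw [Finset.smul_sum, ← Finset.sum_neg_distrib]
    refine Finset.sum_congr rfl fun k _ => ?_
    rw [smul_smul, ← neg_smul]
    congr 1
    rw [lamC, epsC]
    ring
  have h2 : v + ∑ k, s.lamC q v k • s.W k q + s.epsC q v • s.gradh q =
      v + s.epsC q v • s.gradhD q := by
    rw [h1, gradhD_eq, smul_sub]
    abel
  rw [h2, map_add, map_smul, hv, flat_sharp, gradhD, flat_sharp, epsC_eq, ← hv, ← hp]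
  rfl

omit [FiniteDimensional ℝ E] in
lemma impactD_eq_impactC {x : CotangentBundle (E := E) Q} (hx : x ∈ s.Dstar) :
    s.impactD x = s.impactC x := by
  have h0 : ∀ a, s.η a x.proj (s.sharp x.proj x.2) = 0 := hx
  have h1 : s.epsD x.proj (s.sharp x.proj x.2) = s.epsC x.proj (s.sharp x.proj x.2) := by
    rw [epsD, epsC]
    simp [h0]
  have h2 : ∀ k, s.lamD x.proj (s.sharp x.proj x.2) k = s.lamC x.proj (s.sharp x.proj x.2) k := by
    intro k
    rw [lamD, lamC, ← Finset.sum_mul]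
    simp only [h0, mul_zero, Finset.sum_const_zero]
    ring
  simp only [impactD, impactC, h1, h2]

lemma momentum_W (x : CotangentBundle (E := E) Q) (a : Fin m) :
    momentum (s.W a) x = s.η a x.proj (s.sharp x.proj x.2) :=
  s.apply_sharp_comm _ _ _

lemma mem_Dstar_iff {x : CotangentBundle (E := E) Q} :
    x ∈ s.Dstar ↔ ∀ a, momentum (s.W a) x = 0 := by
  simp_rw [momentum_W]
  rfl

/-- The kick is a multiple of `dhD`, which kills Wᵃ. The identity holds on all of T^*Q, so it can be
differentiated in every direction. -/
lemma momentum_W_impactC (x : CotangentBundle (E := E) Q) (a : Fin m) :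
    momentum (s.W a) (s.impactC x) = momentum (s.W a) x := by
  rw [impactC_eq]
  change x.2 (s.W a x.proj) + _ * s.dhD x.proj (s.W a x.proj) = x.2 (s.W a x.proj)
  rw [dhD_W]
  exact (congrArg _ (mul_zero _)).trans (add_zero _)

lemma momentum_gradh (x : CotangentBundle (E := E) Q) :
    momentum s.gradh x = s.dh x.proj (s.sharp x.proj x.2) :=
  s.apply_sharp_comm _ _ _

lemma momentum_gradhD (x : CotangentBundle (E := E) Q) :
    momentum s.gradhD x = s.dhD x.proj (s.sharp x.proj x.2) :=
  s.apply_sharp_comm _ _ _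

lemma sharp_impactC (x : CotangentBundle (E := E) Q) :
    s.sharp (s.impactC x).proj (s.impactC x).2 = s.sharp x.proj x.2 +
      (-2 * x.2 (s.gradhD x.proj) / s.impactDenom x.proj : ℝ) • s.gradhD x.proj := by
  rw [impactC_eq]
  change s.sharp x.proj (x.2 + _ • s.dhD x.proj) = _
  rw [map_add, map_smul]
  rfl

/-- Since dh(`gradhD`) is the denominator of the kick, the division cancels. -/
lemma momentum_gradh_impactC {x : CotangentBundle (E := E) Q} (hx : s.h x.proj = 0) :
    momentum s.gradh (s.impactC x) = momentum s.gradh x - 2 * momentum s.gradhD x := by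
  rw [momentum_gradh, sharp_impactC]
  change s.dh x.proj _ = _
  rw [map_add, map_smul, ← impactDenom_eq, momentum_gradh]
  have := s.impactDenom_ne_zero hx
  change s.dh x.proj (s.sharp x.proj x.2) +
    (-2 * momentum s.gradhD x / s.impactDenom x.proj) * s.impactDenom x.proj = _
  field_simp
  ring

lemma momentum_gradhD_of_mem_Dstar {x : CotangentBundle (E := E) Q} (hx : x ∈ s.Dstar) :
    momentum s.gradhD x = momentum s.gradh x := by
  have h0 : ∀ a, s.η a x.proj (s.sharp x.proj x.2) = 0 := hx
  rw [momentum_gradhD, momentum_gradh, dhD_apply]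
  simp [h0]

end ImpactSystem

end NHImpact
end

/-! ### Smoothness of the objects of the impact system. -/

noncomputable section

namespace NHImpact

lemma contMDiff_matrix_det {E : Type*} [NormedAddCommGroup E] [NormedSpace ℝ E]
    {H : Type*} [TopologicalSpace H] {I : ModelWithCorners ℝ E H} {M : Type*} [TopologicalSpace M]
    [ChartedSpace H M] {m : ℕ} {A : M → Matrix (Fin m) (Fin m) ℝ}
    (hA : ∀ i j, ContMDiff I 𝓘(ℝ, ℝ) ∞ fun x => A x i j) :
    ContMDiff I 𝓘(ℝ, ℝ) ∞ fun x => (A x).det := by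
  simp_rw [Matrix.det_apply']
  exact contMDiff_finsetSum fun σ _ => contMDiff_const.mul
    (contMDiff_finsetProd fun i _ => hA _ _)

lemma contMDiff_matrix_inv {E : Type*} [NormedAddCommGroup E] [NormedSpace ℝ E]
    {H : Type*} [TopologicalSpace H] {I : ModelWithCorners ℝ E H} {M : Type*} [TopologicalSpace M]
    [ChartedSpace H M] {m : ℕ} {A : M → Matrix (Fin m) (Fin m) ℝ}
    (hA : ∀ i j, ContMDiff I 𝓘(ℝ, ℝ) ∞ fun x => A x i j) (hdet : ∀ x, (A x).det ≠ 0)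
    (i j : Fin m) : ContMDiff I 𝓘(ℝ, ℝ) ∞ fun x => (A x)⁻¹ i j := by
  have h : (fun x => (A x)⁻¹ i j) = fun x => (A x).adjugate i j / (A x).det := by
    funext x
    rw [Matrix.inv_def, Matrix.smul_apply, Ring.inverse_eq_inv', smul_eq_mul]
    field_simp [hdet x]
  rw [h]
  refine ContMDiff.div₀ ?_ (contMDiff_matrix_det hA) hdet
  -- By Cramer's rule each entry is a determinant with one row replaced by a constant vector.
  simp_rw [Matrix.adjugate_apply]
  refine contMDiff_matrix_det fun k l => ?_
  by_cases hk : k = j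
  · subst hk
    simp_rw [Matrix.updateRow_self]
    exact contMDiff_const
  · simp_rw [Matrix.updateRow_ne hk]
    exact hA k l

namespace ImpactSystem

open Bundle

variable {E : Type*} [NormedAddCommGroup E] [NormedSpace ℝ E] [FiniteDimensional ℝ E]
variable {Q : Type*} [TopologicalSpace Q] [ChartedSpace E Q] [IsManifold 𝓘(ℝ, E) ∞ Q]
variable {m : ℕ} (s : ImpactSystem E Q m)

lemma contMDiff_sharp : ContMDiff 𝓘(ℝ, E) (𝓘(ℝ, E).prod 𝓘(ℝ, (E →L[ℝ] ℝ) →L[ℝ] E)) ∞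
    (fun q => TotalSpace.mk' ((E →L[ℝ] ℝ) →L[ℝ] E)
      (E := fun q : Q => CotangentSpace (E := E) Q q →L[ℝ] TangentSpace 𝓘(ℝ, E) q)
      q (s.sharp q)) :=
  contMDiff_inverse_section (F₁ := E) (F₂ := E →L[ℝ] ℝ) (E₁ := fun q : Q => TangentSpace 𝓘(ℝ, E) q)
    (E₂ := fun q : Q => CotangentSpace (E := E) Q q) s.flat_isInvertible s.g.contMDiff

variable {EM : Type*} [NormedAddCommGroup EM] [NormedSpace ℝ EM] {HM : Type*} [TopologicalSpace HM]
  {IM : ModelWithCorners ℝ EM HM} {M : Type*} [TopologicalSpace M] [ChartedSpace HM M]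

lemma contMDiff_sharp_apply {b : M → Q} {α : ∀ x, CotangentSpace (E := E) Q (b x)}
    (hα : ContMDiff IM (modelT E) ∞ (fun m => (⟨b m, α m⟩ : CotangentBundle (E := E) Q))) :
    ContMDiff IM (𝓘(ℝ, E).prod 𝓘(ℝ, E)) ∞
      (fun m => TotalSpace.mk' E (E := TangentSpace 𝓘(ℝ, E)) (b m) (s.sharp (b m) (α m))) := by
  have hb : ContMDiff IM 𝓘(ℝ, E) ∞ b := contMDiff_cotangent_proj.comp hα
  exact ContMDiff.clm_bundle_apply (F₁ := E →L[ℝ] ℝ) (F₂ := E)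
    (E₁ := fun q : Q => CotangentSpace (E := E) Q q) (E₂ := fun q : Q => TangentSpace 𝓘(ℝ, E) q)
    (s.contMDiff_sharp.comp hb) hα

lemma contMDiff_W (a : Fin m) : ContMDiff 𝓘(ℝ, E) (𝓘(ℝ, E).prod 𝓘(ℝ, E)) ∞
    (fun q => TotalSpace.mk' E (E := TangentSpace 𝓘(ℝ, E)) q (s.W a q)) :=
  s.contMDiff_sharp_apply (s.η_smooth a)

omit [FiniteDimensional ℝ E] in
lemma contMDiff_dh : ContMDiff 𝓘(ℝ, E) (modelT E) ∞
    (fun q => (⟨q, s.dh q⟩ : CotangentBundle (E := E) Q)) :=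
  contMDiff_mfderiv_section s.h_smooth

lemma contMDiff_massInv (a b : Fin m) : ContMDiff 𝓘(ℝ, E) 𝓘(ℝ, ℝ) ∞ fun q => s.massInv q a b := by
  refine contMDiff_matrix_inv (fun i j => ?_) s.massMatrix_det_ne_zero a b
  simp_rw [massMatrix_apply]
  exact fun q => contMDiffAt_pairing (s.η_smooth i q) (s.contMDiff_W j q)

lemma contMDiff_dhD : ContMDiff 𝓘(ℝ, E) (modelT E) ∞
    (fun q => (⟨q, s.dhD q⟩ : CotangentBundle (E := E) Q)) := by
  refine s.contMDiff_dh.sub_section (ContMDiff.sum_section fun a _ =>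
    ContMDiff.smul_section (contMDiff_finsetSum fun b _ => (s.contMDiff_massInv a b).mul
      fun q => contMDiffAt_pairing (s.contMDiff_dh q) (s.contMDiff_W b q)) (s.η_smooth a))

lemma contMDiff_gradh : ContMDiff 𝓘(ℝ, E) (𝓘(ℝ, E).prod 𝓘(ℝ, E)) ∞
    (fun q => TotalSpace.mk' E (E := TangentSpace 𝓘(ℝ, E)) q (s.gradh q)) :=
  s.contMDiff_sharp_apply s.contMDiff_dh

lemma contMDiff_gradhD : ContMDiff 𝓘(ℝ, E) (𝓘(ℝ, E).prod 𝓘(ℝ, E)) ∞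
    (fun q => TotalSpace.mk' E (E := TangentSpace 𝓘(ℝ, E)) q (s.gradhD q)) :=
  s.contMDiff_sharp_apply s.contMDiff_dhD

lemma contMDiff_impactDenom : ContMDiff 𝓘(ℝ, E) 𝓘(ℝ, ℝ) ∞ s.impactDenom := by
  have h : s.impactDenom = fun q => s.dh q (s.gradhD q) := funext s.impactDenom_eq
  rw [h]
  exact fun q => contMDiffAt_pairing (s.contMDiff_dh q) (s.contMDiff_gradhD q)

omit [FiniteDimensional ℝ E] in
lemma contMDiff_momentum {W : ∀ q : Q, TangentSpace 𝓘(ℝ, E) q}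
    (hW : ContMDiff 𝓘(ℝ, E) (𝓘(ℝ, E).prod 𝓘(ℝ, E)) ∞
      (fun q => TotalSpace.mk' E (E := TangentSpace 𝓘(ℝ, E)) q (W q))) :
    ContMDiff (modelT E) 𝓘(ℝ, ℝ) ∞ (momentum W) := fun x =>
  contMDiffAt_pairing (b := fun y : CotangentBundle (E := E) Q => y.proj)
    (α := fun y => y.2) contMDiffAt_id ((hW.comp contMDiff_cotangent_proj) x)

lemma hamiltonian_eq (x : CotangentBundle (E := E) Q) :
    s.hamiltonian x = 1 / 2 * x.2 (s.sharp x.proj x.2) + s.V x.proj := by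
  rw [hamiltonian, lagrangian, inner_sharp]
  ring

lemma contMDiff_hamiltonian : ContMDiff (modelT E) 𝓘(ℝ, ℝ) ∞ s.hamiltonian := by
  have h : s.hamiltonian = fun x => 1 / 2 * x.2 (s.sharp x.proj x.2) + s.V x.proj :=
    funext s.hamiltonian_eq
  rw [h]
  have h1 : ContMDiff (modelT E) (modelT E) ∞
    (fun y : CotangentBundle (E := E) Q => (⟨y.proj, y.2⟩ : CotangentBundle (E := E) Q)) :=
      contMDiff_id
  refine ContMDiff.add (contMDiff_const.mul fun x => ?_)
    (s.V_smooth.comp contMDiff_cotangent_proj)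
  exact contMDiffAt_pairing (h1 x) (s.contMDiff_sharp_apply h1 x)

/-- Smoothness is in T^*Q, not only along the impact surface, so the impact has a full tangent map
there. -/
lemma contMDiffAt_impactC {x : CotangentBundle (E := E) Q} (hx : s.h x.proj = 0) :
    ContMDiffAt (modelT E) (modelT E) ∞ s.impactC x := by
  have h : s.impactC = fun x => ⟨x.proj, x.2 +
      (-2 * momentum s.gradhD x / s.impactDenom x.proj : ℝ) • s.dhD x.proj⟩ := funext s.impactC_eq
  rw [h]
  refine contMDiffAt_add_smul_bundle (F₁ := E →L[ℝ] ℝ)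
    (E₁ := fun q : Q => CotangentSpace (E := E) Q q) contMDiffAt_id
    ((s.contMDiff_dhD.comp contMDiff_cotangent_proj) x) ?_
  refine ContMDiffAt.div₀ (contMDiffAt_const.mul (contMDiff_momentum s.contMDiff_gradhD x))
    ((s.contMDiff_impactDenom.comp contMDiff_cotangent_proj) x) (s.impactDenom_ne_zero hx)

end ImpactSystem

end NHImpact
end

/-! ### Determinants of fibered maps and derivatives along the fibers. -/

noncomputable section

namespace NHImpact

/-- Scaling the second factor by 2 conjugates the map `U` into its square, so det U = (det U)²; as
`U` is invertible, det U = 1. -/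
lemma det_unipotent {V₁ V₂ : Type*} [AddCommGroup V₁] [Module ℝ V₁] [AddCommGroup V₂] [Module ℝ V₂]
    [FiniteDimensional ℝ V₁] [FiniteDimensional ℝ V₂] (B : V₁ →ₗ[ℝ] V₂) :
    LinearMap.det (LinearMap.id + (LinearMap.inr ℝ V₁ V₂ ∘ₗ B ∘ₗ LinearMap.fst ℝ V₁ V₂)) = 1 := by
  set U := LinearMap.id + (LinearMap.inr ℝ V₁ V₂ ∘ₗ B ∘ₗ LinearMap.fst ℝ V₁ V₂) with hU
  let e : (V₁ × V₂) ≃ₗ[ℝ] (V₁ × V₂) :=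
    (LinearEquiv.refl ℝ V₁).prodCongr (LinearEquiv.smulOfNeZero ℝ V₂ (2 : ℝ) two_ne_zero)
  have h1 : (e : (V₁ × V₂) →ₗ[ℝ] (V₁ × V₂)) ∘ₗ U = U ∘ₗ U ∘ₗ (e : (V₁ × V₂) →ₗ[ℝ] (V₁ × V₂)) := by
    refine LinearMap.ext fun v => Prod.ext ?_ ?_
    · simp [hU, e]
    · simp [hU, e, smul_add, two_smul]
      abel
  have h2 := congrArg LinearMap.det h1
  rw [LinearMap.det_comp, LinearMap.det_comp, LinearMap.det_comp] at h2
  have he : LinearMap.det (e : (V₁ × V₂) →ₗ[ℝ] (V₁ × V₂)) ≠ 0 := (LinearEquiv.isUnit_det' e).ne_zero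
  have hdetU : LinearMap.det U ≠ 0 := by
    have h3 : U ∘ₗ (LinearMap.id - (LinearMap.inr ℝ V₁ V₂ ∘ₗ B ∘ₗ LinearMap.fst ℝ V₁ V₂)) =
        LinearMap.id := by
      refine LinearMap.ext fun v => Prod.ext ?_ ?_ <;> simp [hU]
    have h4 := congrArg LinearMap.det h3
    rw [LinearMap.det_comp, LinearMap.det_id] at h4
    exact left_ne_zero_of_mul_eq_one h4
  have h5 : LinearMap.det U * (LinearMap.det (e : (V₁ × V₂) →ₗ[ℝ] (V₁ × V₂)) *
      (LinearMap.det U - 1)) = 0 := by linear_combination -h2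
  have h6 := (mul_eq_zero.1 h5).resolve_left hdetU
  have h7 := (mul_eq_zero.1 h6).resolve_left he
  linarith

/-- A fibered linear map which covers the identity and is a reflection on the fiber has
determinant `-1`. -/
lemma det_of_fiber_reflection {V₁ V₂ : Type*} [AddCommGroup V₁] [Module ℝ V₁] [AddCommGroup V₂]
    [Module ℝ V₂] [FiniteDimensional ℝ V₁] [FiniteDimensional ℝ V₂]
    (F : V₁ × V₂ →ₗ[ℝ] V₁ × V₂) (f : V₂ →ₗ[ℝ] ℝ) (c : V₂) (hc : f c = -2)
    (h1 : ∀ v, (F v).1 = v.1) (h2 : ∀ β, F (0, β) = (0, β + f β • c)) :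
    LinearMap.det F = -1 := by
  let T := LinearMap.transvection (f ∘ₗ LinearMap.snd ℝ V₁ V₂) ((0 : V₁), c)
  let B : V₁ →ₗ[ℝ] V₂ := LinearMap.snd ℝ V₁ V₂ ∘ₗ F ∘ₗ LinearMap.inl ℝ V₁ V₂
  -- The map is a transvection-type map of the fiber, of determinant 1 + f(c) = −1, followed by a
  -- shear.
  have hF : F = (LinearMap.id + (LinearMap.inr ℝ V₁ V₂ ∘ₗ B ∘ₗ LinearMap.fst ℝ V₁ V₂)) ∘ₗ T := by
    refine LinearMap.ext fun v => ?_
    have hv : v = (v.1, 0) + (0, v.2) := by simp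
    have hFv : F v = F (v.1, 0) + (0, v.2 + f v.2 • c) := by
      conv_lhs => rw [hv, map_add, h2]
    rw [hFv]
    refine Prod.ext ?_ ?_
    · simp [h1, T, LinearMap.transvection.apply]
    · simp [T, B, LinearMap.transvection.apply]
      abel
  rw [hF, LinearMap.det_comp, det_unipotent, LinearMap.transvection.det]
  simp [hc]
  norm_num

/-- Momenta are affine and the Hamiltonian quadratic on fibers, so this serves for both. -/
lemma hasDerivAt_quadratic (a b c : ℝ) :
    HasDerivAt (fun t : ℝ => a + t * b + 1 / 2 * t ^ 2 * c) b 0 := by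
  have h1 := ((hasDerivAt_id (0 : ℝ)).mul_const b).const_add a
  have h2 := (((hasDerivAt_id (0 : ℝ)).pow 2).const_mul (1 / 2 : ℝ)).mul_const c
  exact (h1.add h2).congr_deriv (by simp)

section CotangentDerivatives

variable {E : Type*} [NormedAddCommGroup E] [NormedSpace ℝ E]
variable {Q : Type*} [TopologicalSpace Q] [ChartedSpace E Q] [IsManifold 𝓘(ℝ, E) ∞ Q]

lemma pullbackT_apply (x : CotangentBundle (E := E) Q) (α : CotangentSpace (E := E) Q x.proj)
    (v : E × (E →L[ℝ] ℝ)) : pullbackT x α v = α v.1 :=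
  congrArg α (mfderiv_proj_apply x v)

lemma dT_vertical {f : CotangentBundle (E := E) Q → ℝ} {x : CotangentBundle (E := E) Q}
    (hf : ContMDiff (modelT E) 𝓘(ℝ, ℝ) ∞ f) (β : E →L[ℝ] ℝ) {r : ℝ}
    (h : HasDerivAt (fun t => f (verticalCurve x β t)) r 0) :
    dT f x ((0, β) : E × (E →L[ℝ] ℝ)) = r :=
  (hasDerivAt_verticalCurve ((hf x).mdifferentiableAt (by simp)) β).unique h

lemma dT_momentum_vertical {W : ∀ q : Q, TangentSpace 𝓘(ℝ, E) q}
    (hW : ContMDiff (modelT E) 𝓘(ℝ, ℝ) ∞ (momentum W)) (x : CotangentBundle (E := E) Q)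
    (β : E →L[ℝ] ℝ) : dT (momentum W) x ((0, β) : E × (E →L[ℝ] ℝ)) = β (W x.proj) := by
  refine dT_vertical hW β ?_
  have h : (fun t => momentum W (verticalCurve x β t)) =
      fun t => fiberPart x (W x.proj) + t * β (W x.proj) := rfl
  rw [h]
  simpa using hasDerivAt_quadratic (fiberPart x (W x.proj)) (β (W x.proj)) 0

lemma dT_comp {f : CotangentBundle (E := E) Q → ℝ} (hf : ContMDiff (modelT E) 𝓘(ℝ, ℝ) ∞ f)
    {Δ : CotangentBundle (E := E) Q → CotangentBundle (E := E) Q} {x : CotangentBundle (E := E) Q}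
    (hΔ : MDifferentiableAt (modelT E) (modelT E) Δ x) (h : ∀ y, f (Δ y) = f y)
    (v : TangentSpace (modelT E) x) :
    dT f (Δ x) (mfderiv (modelT E) (modelT E) Δ x v) = dT f x v := by
  have h1 := mfderiv_comp x ((hf (Δ x)).mdifferentiableAt (by simp)) hΔ
  have h2 : f ∘ Δ = f := funext h
  rw [h2] at h1
  exact (congrArg (fun L : (E × (E →L[ℝ] ℝ)) →L[ℝ] ℝ => L v) h1).symm

lemma mfderiv_comp_proj {f : Q → ℝ} (hf : ContMDiff 𝓘(ℝ, E) 𝓘(ℝ, ℝ) ∞ f)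
    (x : CotangentBundle (E := E) Q) (v : E × (E →L[ℝ] ℝ)) :
    mfderiv (modelT E) 𝓘(ℝ, ℝ) (fun y : CotangentBundle (E := E) Q => f y.proj) x v =
      mfderiv 𝓘(ℝ, E) 𝓘(ℝ, ℝ) f x.proj v.1 := by
  have h1 := mfderiv_comp x ((hf x.proj).mdifferentiableAt (by simp))
    ((contMDiff_cotangent_proj (E := E) (Q := Q) x).mdifferentiableAt (by simp))
  have h2 := congrArg (fun L : (E × (E →L[ℝ] ℝ)) →L[ℝ] ℝ => L v) h1
  exact h2.trans (congrArg (mfderiv 𝓘(ℝ, E) 𝓘(ℝ, ℝ) f x.proj) (mfderiv_proj_apply x v))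

variable {G G' : Type*} [NormedAddCommGroup G] [NormedSpace ℝ G] [NormedAddCommGroup G']
  [NormedSpace ℝ G']

lemma mfderiv_clm_comp (L : G →L[ℝ] G') {f : CotangentBundle (E := E) Q → G}
    {x : CotangentBundle (E := E) Q} (hf : MDifferentiableAt (modelT E) 𝓘(ℝ, G) f x)
    (v : E × (E →L[ℝ] ℝ)) :
    mfderiv (modelT E) 𝓘(ℝ, G') (fun y => L (f y)) x v =
      L (mfderiv (modelT E) 𝓘(ℝ, G) f x v) := by
  have h1 := (L.hasMFDerivAt (x := f x)).comp x hf.hasMFDerivAt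
  exact congrArg (fun K : (E × (E →L[ℝ] ℝ)) →L[ℝ] G' => K v) h1.mfderiv

end CotangentDerivatives

namespace ImpactSystem

variable {E : Type*} [NormedAddCommGroup E] [NormedSpace ℝ E] [FiniteDimensional ℝ E]
variable {Q : Type*} [TopologicalSpace Q] [ChartedSpace E Q] [IsManifold 𝓘(ℝ, E) ∞ Q]
variable {m : ℕ} (s : ImpactSystem E Q m)

lemma dT_hamiltonian_vertical (x : CotangentBundle (E := E) Q) (β : E →L[ℝ] ℝ) :
    dT s.hamiltonian x ((0, β) : E × (E →L[ℝ] ℝ)) = β (s.sharp x.proj x.2) := by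
  refine dT_vertical s.contMDiff_hamiltonian β ?_
  let β' : CotangentSpace (E := E) Q x.proj := β
  have h : (fun t => s.hamiltonian (verticalCurve x β t)) = fun t : ℝ =>
      s.hamiltonian x + t * β (s.sharp x.proj x.2) + 1 / 2 * t ^ 2 * β (s.sharp x.proj β') := by
    funext t
    rw [hamiltonian_eq, hamiltonian_eq]
    have h1 : s.sharp x.proj (verticalCurve x β t).2 = s.sharp x.proj x.2 +
        t • s.sharp x.proj β' := by
      rw [← map_smul, ← map_add]
      rfl
    have h2 : ∀ w : TangentSpace 𝓘(ℝ, E) x.proj,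
        (verticalCurve x β t).2 w = (x.2 w + t * β w : ℝ) := fun w => rfl
    change 1 / 2 * (verticalCurve x β t).2 (s.sharp x.proj (verticalCurve x β t).2) +
      s.V x.proj = _
    have h3 : (x.2 (s.sharp x.proj β') : ℝ) = β (s.sharp x.proj x.2) :=
      s.apply_sharp_comm x.proj x.2 β'
    have h4 : ∀ γ : CotangentSpace (E := E) Q x.proj,
        (γ (s.sharp x.proj x.2 + t • s.sharp x.proj β') : ℝ) =
          γ (s.sharp x.proj x.2) + t * γ (s.sharp x.proj β') := fun γ =>
      (map_add γ _ _).trans (congrArg _ (map_smul γ t _))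
    rw [h2, h1, h4 x.2, show β (s.sharp x.proj x.2 + t • s.sharp x.proj β') = _ from h4 β', h3]
    change _ = 1 / 2 * (x.2 (s.sharp x.proj x.2) : ℝ) + s.V x.proj + _ + _
    change 1 / 2 * ((x.2 (s.sharp x.proj x.2) : ℝ) + t * β (s.sharp x.proj x.2) +
      t * (β (s.sharp x.proj x.2) + t * β (s.sharp x.proj β'))) + s.V x.proj = _
    ring
  rw [h]
  exact hasDerivAt_quadratic _ _ _

/-- Testing against vertical vectors kills the pullback term and leaves q̇ = ∂H/∂p, whatever the
constraint force is. -/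
lemma fst_of_symplectic_eq {x : CotangentBundle (E := E) Q} {X : E × (E →L[ℝ] ℝ)}
    {α : CotangentSpace (E := E) Q x.proj}
    (h : ∀ v : TangentSpace (modelT E) x, symplecticForm x ![X, v] =
      dT s.hamiltonian x v + pullbackT x α v) : X.1 = s.sharp x.proj x.2 := by
  have key : ∀ β : E →L[ℝ] ℝ, β X.1 = β (s.sharp x.proj x.2) := by
    intro β
    have h1 := h ((0, β) : E × (E →L[ℝ] ℝ))
    rw [dT_hamiltonian_vertical] at h1
    have h2 : pullbackT x α ((0, β) : E × (E →L[ℝ] ℝ)) = 0 :=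
      (pullbackT_apply x α _).trans (map_zero α)
    have h3 := symplecticForm_apply x X (0, β)
    have h4 : X.2 (0 : E) = 0 := map_zero _
    simp only [h4, sub_zero] at h3
    rw [← h3]
    exact h1.trans (by rw [h2, add_zero])
  exact (SeparatingDual.eq_iff_forall_dual_eq (R := ℝ) (V := E)).2 key

end ImpactSystem

end NHImpact
end

/-! ### The tangent map of the impact and the nonholonomic vector field. -/

noncomputable section

namespace NHImpact

lemma sub_sum_smul_apply {V : Type*} [AddCommGroup V] [Module ℝ V] {m : ℕ} (L : V →ₗ[ℝ] ℝ)
    (c : Fin m → Fin m → ℝ) (P : Fin m → V →ₗ[ℝ] ℝ) (v : V) :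
    (L - ∑ a, ∑ b, c a b • P b) v = L v + ∑ b, (-∑ a, c a b) * P b v := by
  simp only [LinearMap.sub_apply, LinearMap.sum_apply, LinearMap.smul_apply, smul_eq_mul, neg_mul,
    Finset.sum_neg_distrib, Finset.sum_mul]
  rw [sub_eq_add_neg, Finset.sum_comm]

namespace ImpactSystem

variable {E : Type*} [NormedAddCommGroup E] [NormedSpace ℝ E] [FiniteDimensional ℝ E]
variable {Q : Type*} [TopologicalSpace Q] [ChartedSpace E Q] [IsManifold 𝓘(ℝ, E) ∞ Q]
variable {m : ℕ} (s : ImpactSystem E Q m)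

/-- The derivative of the global impact map as a continuous linear map of the model space. -/
def dImpactL (x : CotangentBundle (E := E) Q) : E × (E →L[ℝ] ℝ) →L[ℝ] E × (E →L[ℝ] ℝ) :=
  mfderiv (modelT E) (modelT E) s.impactC x

/-- The derivative of the global impact map in bundle coordinates. -/
def dImpact (x : CotangentBundle (E := E) Q) : E × (E →L[ℝ] ℝ) →ₗ[ℝ] E × (E →L[ℝ] ℝ) :=
  (s.dImpactL x).toLinearMap

lemma mdifferentiableAt_impactC {x : CotangentBundle (E := E) Q} (hx : s.h x.proj = 0) :
    MDifferentiableAt (modelT E) (modelT E) s.impactC x :=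
  (s.contMDiffAt_impactC hx).mdifferentiableAt (by simp)

lemma dImpact_fst {x : CotangentBundle (E := E) Q} (hx : s.h x.proj = 0)
    (v : E × (E →L[ℝ] ℝ)) : (s.dImpact x v).1 = v.1 := by
  have h1 := mfderiv_comp x
    ((contMDiff_cotangent_proj (E := E) (Q := Q) (s.impactC x)).mdifferentiableAt (by simp))
    (s.mdifferentiableAt_impactC hx)
  have h2 := congrArg (fun L : (E × (E →L[ℝ] ℝ)) →L[ℝ] E => L v) h1
  exact ((mfderiv_proj_apply (s.impactC x) (s.dImpact x v)).symm.trans h2.symm).trans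
    (mfderiv_proj_apply x v)

/-- The covector `π_𝒟^* dh` in the model fiber. -/
def kickCovector (q : Q) : E →L[ℝ] ℝ := s.dhD q

/-- The gradient of `h` along `𝒟` in the model fiber. -/
def kickVector (q : Q) : E := s.gradhD q

/-- The linear functional by which the impact reflects the momenta over `q`. -/
def kickFunctional (q : Q) : (E →L[ℝ] ℝ) →ₗ[ℝ] ℝ :=
  (-2 / s.impactDenom q) • (ContinuousLinearMap.apply ℝ ℝ (s.kickVector q)).toLinearMap

omit [FiniteDimensional ℝ E] in
lemma kickFunctional_apply (q : Q) (β : E →L[ℝ] ℝ) :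
    s.kickFunctional q β = -2 / s.impactDenom q * β (s.kickVector q) := rfl

/-- The impact is linear on each fiber, so it carries vertical lines to vertical lines; this
computes its vertical derivative without coordinates. -/
lemma impactC_verticalCurve (x : CotangentBundle (E := E) Q) (β : E →L[ℝ] ℝ) (t : ℝ) :
    s.impactC (verticalCurve x β t) = verticalCurve (s.impactC x)
      (β + s.kickFunctional x.proj β • s.kickCovector x.proj) t := by
  rw [impactC_eq, impactC_eq]
  refine congrArg (Bundle.TotalSpace.mk x.proj) ?_
  have key : ∀ (p β c : E →L[ℝ] ℝ) (u : E) (r : ℝ),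
      (p + t • β) + (-2 * (p + t • β) u / r) • c =
        (p + (-2 * p u / r) • c) + t • (β + (-2 / r * β u) • c) := by
    intro p β c u r
    ext w
    simp
    ring
  exact key (fiberPart x) β (s.kickCovector x.proj) (s.kickVector x.proj) (s.impactDenom x.proj)

lemma dImpact_vertical {x : CotangentBundle (E := E) Q} (hx : s.h x.proj = 0) (β : E →L[ℝ] ℝ) :
    s.dImpact x (0, β) = (0, β + s.kickFunctional x.proj β • s.kickCovector x.proj) := by
  set β' := β + s.kickFunctional x.proj β • s.kickCovector x.proj with hβ'
  have h0 : HasMFDerivAt (modelT E) (modelT E) s.impactC (verticalCurve x β 0)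
      (s.dImpactL x) := by
    rw [verticalCurve_zero]
    exact (s.mdifferentiableAt_impactC hx).hasMFDerivAt
  have h1 := h0.comp (0 : ℝ) (hasMFDerivAt_verticalCurve x β)
  have h2 : s.impactC ∘ verticalCurve x β = verticalCurve (s.impactC x) β' :=
    funext fun t => s.impactC_verticalCurve x β t
  rw [h2] at h1
  have h1' : HasMFDerivAt 𝓘(ℝ, ℝ) (modelT E) (verticalCurve (s.impactC x) β') 0
      ((s.dImpactL x).comp (ContinuousLinearMap.toSpanSingleton ℝ ((0, β) : E × (E →L[ℝ] ℝ)))) := h1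
  have h3 := hasMFDerivAt_unique h1' (hasMFDerivAt_verticalCurve (s.impactC x) β')
  have h4 := congrArg (fun L : ℝ →L[ℝ] E × (E →L[ℝ] ℝ) => L 1) h3
  have h5 : s.dImpactL x ((1 : ℝ) • (0, β)) = (1 : ℝ) • ((0 : E), β') := h4
  rw [one_smul, one_smul] at h5
  exact h5

/-- The kick functional takes the value −2 on the kick covector, because `dhD`(`gradhD`) is the
denominator; the fiber part is thus a reflection. -/
lemma det_dImpact {x : CotangentBundle (E := E) Q} (hx : s.h x.proj = 0) :
    LinearMap.det (s.dImpact x) = -1 := by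
  refine det_of_fiber_reflection (s.dImpact x) (s.kickFunctional x.proj) (s.kickCovector x.proj) ?_
    (s.dImpact_fst hx) (s.dImpact_vertical hx)
  have h1 : s.kickCovector x.proj (s.kickVector x.proj) = s.impactDenom x.proj :=
    s.dhD_gradhD x.proj
  have h2 := s.impactDenom_ne_zero hx
  rw [kickFunctional_apply, h1]
  field_simp

/-- Vertical vectors dual to the differentials of the momenta `P(Wᵃ)`. -/
def dualVertical (x : CotangentBundle (E := E) Q) (b : Fin m) : E × (E →L[ℝ] ℝ) :=
  (0, ∑ c, s.massInv x.proj c b • (show E →L[ℝ] ℝ from s.η c x.proj))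

lemma dT_momentum_W_vertical (x : CotangentBundle (E := E) Q) (a : Fin m) (β : E →L[ℝ] ℝ) :
    dT (momentum (s.W a)) x ((0, β) : E × (E →L[ℝ] ℝ)) = β (s.W a x.proj) :=
  dT_momentum_vertical (contMDiff_momentum (s.contMDiff_W a)) x β

lemma dT_dualVertical (x : CotangentBundle (E := E) Q) (a b : Fin m) :
    dT (momentum (s.W a)) x (s.dualVertical x b) = if a = b then 1 else 0 := by
  refine (s.dT_momentum_W_vertical x a _).trans ?_
  rw [← s.sum_massMatrix_massInv x.proj a b]
  refine (sum_smul_apply (E := E) (fun c => s.massInv x.proj c b) (fun c => s.η c x.proj) _).trans ?_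
  refine Finset.sum_congr rfl fun c _ => ?_
  rw [massMatrix_symm, massMatrix_apply]
  exact mul_comm _ _

lemma symplecticForm_nhField (x : CotangentBundle (E := E) Q) (v : TangentSpace (modelT E) x) :
    symplecticForm x ![s.nhField x, v] = dT s.hamiltonian x v +
      ∑ b, (-∑ a, s.massInv x.proj a b * poisson s.hamiltonian (momentum (s.W a)) x) *
        pullbackT x (s.η b x.proj) v :=
  (symplecticDual_spec x _ v).trans (sub_sum_smul_apply _ _ _ _)

omit [FiniteDimensional ℝ E] in
lemma sum_pullbackT (s : ImpactSystem E Q m) (x : CotangentBundle (E := E) Q) (c : Fin m → ℝ)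
    (v : TangentSpace (modelT E) x) : ∑ a, c a * pullbackT x (s.η a x.proj) v =
      pullbackT x (∑ a, c a • s.η a x.proj) v :=
  (sum_smul_apply (E := E) c (fun a => s.η a x.proj) _).symm

lemma fst_of_multipliers {x : CotangentBundle (E := E) Q} {X : E × (E →L[ℝ] ℝ)} (c : Fin m → ℝ)
    (h : ∀ v : TangentSpace (modelT E) x, symplecticForm x ![X, v] =
      dT s.hamiltonian x v + ∑ a, c a * pullbackT x (s.η a x.proj) v) :
    X.1 = s.sharp x.proj x.2 :=
  s.fst_of_symplectic_eq (α := ∑ a, c a • s.η a x.proj) fun v =>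
    (h v).trans (congrArg _ (s.sum_pullbackT x c v))

/-- A vector tangent to the cotangent bundle, in bundle coordinates. -/
def modelVector {x : CotangentBundle (E := E) Q} (X : TangentSpace (modelT E) x) :
    E × (E →L[ℝ] ℝ) := X

lemma nhField_fst (x : CotangentBundle (E := E) Q) :
    (modelVector (s.nhField x)).1 = s.sharp x.proj x.2 :=
  s.fst_of_multipliers _ (s.symplecticForm_nhField x)

lemma IsNonholonomicField.fst_eq {X : ∀ x : CotangentBundle (E := E) Q, TangentSpace (modelT E) x}
    (hX : s.IsNonholonomicField X) {x : CotangentBundle (E := E) Q} (hx : x ∈ s.Dstar) :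
    (modelVector (X x)).1 = s.sharp x.proj x.2 := by
  obtain ⟨-, lam, h⟩ := hX x hx
  exact s.fst_of_multipliers lam h

/-- With Y the Hamiltonian field of P(Wᵃ), the derivative is −ω(Ξ, Y) = −{H, P(Wᵃ)} + m_{cb} m^{ab}
{H, P(Wᶜ)}. The multipliers are chosen so that inverting the mass matrix cancels the two terms. -/
lemma dT_momentum_nhField (x : CotangentBundle (E := E) Q) (a : Fin m) :
    dT (momentum (s.W a)) x (s.nhField x) = 0 := by
  set Y := symplecticDual x (dT (momentum (s.W a)) x) with hY
  have hY1 : (modelVector Y).1 = s.W a x.proj := by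
    refine (SeparatingDual.eq_iff_forall_dual_eq (R := ℝ) (V := E)).2 fun β => ?_
    have h1 := symplecticDual_spec x (dT (momentum (s.W a)) x) ((0, β) : E × (E →L[ℝ] ℝ))
    have h2 := symplecticForm_apply x Y (0, β)
    have h4 : (modelVector Y).2 (0 : E) = 0 := map_zero _
    exact ((sub_eq_self.2 h4).symm.trans (h2.symm.trans h1)).trans (s.dT_momentum_W_vertical x a β)
  have h1 : dT (momentum (s.W a)) x (s.nhField x) = - symplecticForm x ![s.nhField x, Y] := by
    rw [← symplecticForm_swap]
    exact (symplecticDual_spec x _ _).symm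
  have h2 : dT s.hamiltonian x Y = poisson s.hamiltonian (momentum (s.W a)) x :=
    (symplecticDual_spec x _ _).symm
  have h3 : ∀ b, pullbackT x (s.η b x.proj) Y = s.massMatrix x.proj a b := by
    intro b
    rw [massMatrix_symm, massMatrix_apply]
    exact (pullbackT_apply x _ _).trans (congrArg (s.η b x.proj) hY1)
  rw [h1, symplecticForm_nhField, h2]
  simp_rw [h3]
  have h4 : ∑ b, (-∑ c, s.massInv x.proj c b * poisson s.hamiltonian (momentum (s.W c)) x) *
      s.massMatrix x.proj a b = - ∑ c, (∑ b, s.massMatrix x.proj a b * s.massInv x.proj b c) *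
        poisson s.hamiltonian (momentum (s.W c)) x := by
    have hs : ∀ c b, s.massInv x.proj c b = s.massInv x.proj b c := fun c b => by
      have h5 : (s.massMatrix x.proj).IsSymm := Matrix.IsSymm.ext fun i j => s.massMatrix_symm _ _ _
      exact h5.inv.apply b c
    simp only [neg_mul, Finset.sum_neg_distrib, Finset.sum_mul]
    rw [Finset.sum_comm]
    refine congrArg Neg.neg (Finset.sum_congr rfl fun c _ => Finset.sum_congr rfl fun b _ => ?_)
    rw [hs c b]
    ring
  rw [h4]
  simp [sum_massMatrix_massInv]

lemma isNonholonomicField_nhField : s.IsNonholonomicField s.nhField := fun x _ =>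
  ⟨s.dT_momentum_nhField x, _, s.symplecticForm_nhField x⟩

lemma dhField_eq (x : CotangentBundle (E := E) Q) : s.dhField x = momentum s.gradh x := by
  rw [momentum_gradh]
  exact (pullbackT_apply x _ _).trans (congrArg (s.dh x.proj) (s.nhField_fst x))

lemma dhProjField_eq (x : CotangentBundle (E := E) Q) :
    s.dhProjField x = momentum s.gradhD x := by
  rw [momentum_gradhD, dhD_eq_dh_projD]
  exact congrArg (fun w => s.dh x.proj (s.projD x.proj w))
    ((mfderiv_proj_apply x _).trans (s.nhField_fst x))

end ImpactSystem

end NHImpact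
end

/-! ### The hybrid Jacobian for a family of invariant constraints. -/

noncomputable section

namespace NHImpact

variable {E : Type*} [NormedAddCommGroup E] [NormedSpace ℝ E] [FiniteDimensional ℝ E]
variable {Q : Type*} [TopologicalSpace Q] [ChartedSpace E Q] [IsManifold 𝓘(ℝ, E) ∞ Q]
variable {m : ℕ}

/-- Independent constraint functions on the cotangent bundle which the global impact map
preserves, with vertical vectors dual to their differentials. -/
structure InvariantConstraints (s : ImpactSystem E Q m) (k : ℕ) where
  f : Fin k → CotangentBundle (E := E) Q → ℝ
  smooth : ∀ a, ContMDiff (modelT E) 𝓘(ℝ, ℝ) ∞ (f a)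
  invariant : ∀ a x, f a (s.impactC x) = f a x
  dual : CotangentBundle (E := E) Q → Fin k → E × (E →L[ℝ] ℝ)
  dT_dual : ∀ x a b, dT (f a) x (dual x b) = if a = b then 1 else 0
  dual_fst : ∀ x b, (dual x b).1 = 0

namespace InvariantConstraints

variable {s : ImpactSystem E Q m} {k d : ℕ} (c : InvariantConstraints s k)

/-- The common zero set of the constraints. -/
def zeroSet : Set (CotangentBundle (E := E) Q) := {x | ∀ a, c.f a x = 0}

/-- The differentials of the constraints. -/
def theta (x : CotangentBundle (E := E) Q) (a : Fin k) : E × (E →L[ℝ] ℝ) →ₗ[ℝ] ℝ := dT (c.f a) x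

omit [FiniteDimensional ℝ E] in
lemma theta_dual (x : CotangentBundle (E := E) Q) (a b : Fin k) :
    c.theta x a (c.dual x b) = if a = b then 1 else 0 := c.dT_dual x a b

end InvariantConstraints

namespace ImpactSystem

variable (s : ImpactSystem E Q m)

/-- The pullback of `dh` to the cotangent bundle, in bundle coordinates. -/
def dhBase (q : Q) : E × (E →L[ℝ] ℝ) →ₗ[ℝ] ℝ :=
  (show E →L[ℝ] ℝ from s.dh q).toLinearMap ∘ₗ LinearMap.fst ℝ E (E →L[ℝ] ℝ)

omit [FiniteDimensional ℝ E] in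
lemma dhBase_apply (q : Q) (v : E × (E →L[ℝ] ℝ)) : s.dhBase q v = s.dh q v.1 := rfl

end ImpactSystem

namespace InvariantConstraints

variable {s : ImpactSystem E Q m} {k d : ℕ} (c : InvariantConstraints s k)

/-- The constraints together with the impact function. -/
def level (x : CotangentBundle (E := E) Q) : ℝ × (Fin k → ℝ) := (s.h x.proj, fun a => c.f a x)

omit [FiniteDimensional ℝ E] in
lemma contMDiff_level : ContMDiff (modelT E) 𝓘(ℝ, ℝ × (Fin k → ℝ)) ∞ c.level :=
  (s.h_smooth.comp contMDiff_cotangent_proj).prodMk_space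
    (contMDiff_pi_space.2 fun a => c.smooth a)

/-- The derivative of the level map. -/
def dLevel (x : CotangentBundle (E := E) Q) : E × (E →L[ℝ] ℝ) →L[ℝ] ℝ × (Fin k → ℝ) :=
  mfderiv (modelT E) 𝓘(ℝ, ℝ × (Fin k → ℝ)) c.level x

omit [FiniteDimensional ℝ E] in
lemma dLevel_fst (x : CotangentBundle (E := E) Q) (v : E × (E →L[ℝ] ℝ)) :
    (c.dLevel x v).1 = s.dhBase x.proj v := by
  have h1 := mfderiv_clm_comp (ContinuousLinearMap.fst ℝ ℝ (Fin k → ℝ))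
    ((c.contMDiff_level x).mdifferentiableAt (by simp)) v
  exact h1.symm.trans (mfderiv_comp_proj s.h_smooth x v)

omit [FiniteDimensional ℝ E] in
lemma dLevel_snd (x : CotangentBundle (E := E) Q) (v : E × (E →L[ℝ] ℝ)) (a : Fin k) :
    (c.dLevel x v).2 a = c.theta x a v :=
  (mfderiv_clm_comp ((ContinuousLinearMap.proj (R := ℝ) (φ := fun _ : Fin k => ℝ) a).comp
    (ContinuousLinearMap.snd ℝ ℝ (Fin k → ℝ)))
    ((c.contMDiff_level x).mdifferentiableAt (by simp)) v).symm

omit [FiniteDimensional ℝ E] in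
lemma dLevel_eq_zero_iff {x : CotangentBundle (E := E) Q} {v : E × (E →L[ℝ] ℝ)} :
    c.dLevel x v = 0 ↔ s.dhBase x.proj v = 0 ∧ ∀ a, c.theta x a v = 0 := by
  rw [Prod.ext_iff, funext_iff]
  simp only [dLevel_fst, dLevel_snd]
  rfl

omit [FiniteDimensional ℝ E] in
lemma surjective_dLevel {x : CotangentBundle (E := E) Q} {X : E × (E →L[ℝ] ℝ)}
    (hX : ∀ a, c.theta x a X = 0) (hℓ : s.dhBase x.proj X ≠ 0) :
    Function.Surjective (c.dLevel x) := by
  rintro ⟨r, y⟩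
  -- The dual vectors are vertical and invisible to dh, while `X` is annihilated by the constraints,
  -- so the two components are reached independently.
  refine ⟨(r / s.dhBase x.proj X) • X + ∑ b, y b • c.dual x b, ?_⟩
  have h0 : ∀ b, s.dhBase x.proj (c.dual x b) = 0 := fun b => by
    rw [ImpactSystem.dhBase_apply, c.dual_fst]
    exact map_zero (s.dh x.proj)
  refine Prod.ext ?_ (funext fun a => ?_)
  · rw [dLevel_fst, map_add, map_sum, map_smul]
    simp [h0, hℓ]
  · rw [dLevel_snd, map_add, map_sum, map_smul, hX]
    simp [theta_dual]

omit [FiniteDimensional ℝ E] in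
lemma dLevel_eq_zero_of_mem_tangentDirections {x : CotangentBundle (E := E) Q}
    (hx : x ∈ s.Sstar ∩ c.zeroSet) {v : TangentSpace (modelT E) x}
    (hv : v ∈ tangentDirections (modelT E) (s.Sstar ∩ c.zeroSet) x) : c.dLevel x v = 0 :=
  mfderiv_eq_zero_of_mem_tangentDirections (I := modelT E) hx
    ((c.contMDiff_level x).mdifferentiableAt (by simp)) (c := 0)
    (fun _ hy => Prod.ext hy.1.1 (funext hy.2)) hv

lemma mem_tangentDirections_of_dLevel_eq_zero {x : CotangentBundle (E := E) Q}
    (hx : x ∈ s.Sstar ∩ c.zeroSet) (hs : Function.Surjective (c.dLevel x))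
    {v : TangentSpace (modelT E) x} (hv : c.dLevel x v = 0) :
    v ∈ tangentDirections (modelT E) (s.Sstar ∩ c.zeroSet) x := by
  have : IsManifold (modelT E) 1 (CotangentBundle (E := E) Q) :=
    IsManifold.of_le (n := ∞) (by simp)
  refine mem_tangentDirections_of_submersion (I := modelT E) (f := c.level)
    ((c.contMDiff_level x).of_le (by simp)) hs ?_ hv
  -- The inequality P(∇h) < 0 is open, so near `x` the impact surface is a full level set of
  -- `level`.
  have h1 : ∀ᶠ y in 𝓝 x, momentum s.gradh y < 0 :=
    (ImpactSystem.contMDiff_momentum s.contMDiff_gradh).continuous.continuousAt.eventually_lt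
      continuousAt_const hx.1.2
  have h0 : c.level x = 0 := Prod.ext hx.1.1 (funext hx.2)
  filter_upwards [h1] with y hy hxy
  rw [h0] at hxy
  exact ⟨⟨congrArg Prod.fst hxy, hy⟩, fun a => congrFun (congrArg Prod.snd hxy) a⟩

/-- The map `Δ` matters only on `S`, so the local and the global impact maps can share one tangent
map. -/
lemma mfderivWithin_eq_dImpact {Δ : CotangentBundle (E := E) Q → CotangentBundle (E := E) Q}
    {S : Set (CotangentBundle (E := E) Q)} (hΔ : ∀ x ∈ S, Δ x = s.impactC x)
    {x : CotangentBundle (E := E) Q} (hx : x ∈ S) (hh : s.h x.proj = 0)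
    {v : TangentSpace (modelT E) x} (hv : v ∈ tangentDirections (modelT E) S x) :
    mfderivWithin (modelT E) (modelT E) Δ S x v = s.dImpact x v := by
  have h1 : HasMFDerivWithinAt (modelT E) (modelT E) Δ S x (s.dImpactL x) :=
    (s.mdifferentiableAt_impactC hh).hasMFDerivAt.hasMFDerivWithinAt.congr_of_eventuallyEq
      (Filter.eventually_of_mem self_mem_nhdsWithin hΔ) (hΔ x hx)
  exact HasMFDerivWithinAt.eq_on_tangentDirections
    h1.mdifferentiableWithinAt.hasMFDerivWithinAt h1 hv

lemma theta_dImpact {x : CotangentBundle (E := E) Q} (hh : s.h x.proj = 0) (a : Fin k)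
    (v : E × (E →L[ℝ] ℝ)) : c.theta (s.impactC x) a (s.dImpact x v) = c.theta x a v :=
  dT_comp (c.smooth a) (s.mdifferentiableAt_impactC hh) (c.invariant a) v

lemma dhBase_dImpact {x : CotangentBundle (E := E) Q} (hh : s.h x.proj = 0)
    (v : E × (E →L[ℝ] ℝ)) : s.dhBase x.proj (s.dImpact x v) = s.dhBase x.proj v := by
  rw [ImpactSystem.dhBase_apply, s.dImpact_fst hh, ImpactSystem.dhBase_apply]

/-- The hypothesis `hJ` says J = −dh(X∘Δ)/dh(X), the value found from det F = −1. No constraint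
gives the global system, the m constraints P(Wᵃ) the nonholonomic one. -/
theorem isHybridJacobian_and_unique (e : k + d = 2 * Module.finrank ℝ E)
    {X : ∀ x : CotangentBundle (E := E) Q, TangentSpace (modelT E) x}
    (hX : ∀ x ∈ c.zeroSet, (ImpactSystem.modelVector (X x)).1 = s.sharp x.proj x.2)
    (hXf : ∀ x ∈ c.zeroSet, ∀ a, dT (c.f a) x (X x) = 0)
    {ε : ∀ x : CotangentBundle (E := E) Q, (TangentSpace (modelT E) x) [⋀^Fin d]→ₗ[ℝ] ℝ}
    (hε : ∀ x ∈ c.zeroSet, IsFormQuotient e (fun a => dT (c.f a) x) (ImpactSystem.liouville x) (ε x))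
    {Δ : CotangentBundle (E := E) Q → CotangentBundle (E := E) Q}
    (hΔ : ∀ x ∈ s.Sstar ∩ c.zeroSet, Δ x = s.impactC x) {J : CotangentBundle (E := E) Q → ℝ}
    (hJs : ContMDiffOn (modelT E) 𝓘(ℝ, ℝ) ∞ J (s.Sstar ∩ c.zeroSet))
    (hJ : ∀ x ∈ s.Sstar ∩ c.zeroSet,
      J x * momentum s.gradh x = - momentum s.gradh (s.impactC x)) :
    IsHybridJacobian (modelT E) (s.Sstar ∩ c.zeroSet) X Δ ε J ∧
      ∀ J', IsHybridJacobian (modelT E) (s.Sstar ∩ c.zeroSet) X Δ ε J' →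
        ∀ x ∈ s.Sstar ∩ c.zeroSet, J' x = J x := by
  have hℓ : ∀ x ∈ c.zeroSet, s.dhBase x.proj (ImpactSystem.modelVector (X x)) = momentum s.gradh x := by
    intro x hx
    rw [ImpactSystem.dhBase_apply, hX x hx, ImpactSystem.momentum_gradh]
  have hne : ∀ x ∈ s.Sstar ∩ c.zeroSet, s.dhBase x.proj (ImpactSystem.modelVector (X x)) ≠ 0 := by
    intro x hx
    rw [hℓ x hx.2]
    exact hx.1.2.ne
  have hpull : ∀ x ∈ s.Sstar ∩ c.zeroSet, ∀ v : Fin (d - 1) → TangentSpace (modelT E) x,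
      (∀ i, v i ∈ tangentDirections (modelT E) (s.Sstar ∩ c.zeroSet) x) →
      interior (ε (Δ x)) (X (Δ x)) (fun i => mfderivWithin (modelT E) (modelT E) Δ
        (s.Sstar ∩ c.zeroSet) x (v i)) = J x * interior (ε x) (X x) v := by
    intro x hx v hv
    have hh : s.h x.proj = 0 := hx.1.1
    have hy : s.impactC x ∈ c.zeroSet := fun a => (c.invariant a x).trans (hx.2 a)
    have hk := fun i => c.dLevel_eq_zero_iff.1 (c.dLevel_eq_zero_of_mem_tangentDirections hx (hv i))
    have h1 : (fun i => mfderivWithin (modelT E) (modelT E) Δ (s.Sstar ∩ c.zeroSet) x (v i)) =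
        fun i => s.dImpact x (v i) :=
      funext fun i => mfderivWithin_eq_dImpact hΔ hx hh (hv i)
    rw [h1, hΔ x hx]
    have hεy := hε _ hy
    -- In the model space the volume forms at the two points coincide, so a single form `μ` serves
    -- for both.
    rw [liouville_eq (s.impactC x) x] at hεy
    have hℓy : s.dhBase x.proj (ImpactSystem.modelVector (X (s.impactC x))) = momentum s.gradh (s.impactC x) :=
      hℓ _ hy
    have hj : J x * s.dhBase x.proj (ImpactSystem.modelVector (X x)) =
        -s.dhBase x.proj (ImpactSystem.modelVector (X (s.impactC x))) := by
      rw [hℓ x hx.2, hℓy]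
      exact hJ x hx
    exact IsFormQuotient.interior_map (V := E × (E →L[ℝ] ℝ)) finrank_model (c.theta_dual x)
      (s.det_dImpact hh) (c.theta_dImpact hh) (dhBase_dImpact hh) (hXf x hx.2) (hXf _ hy)
      (hne x hx) hj
      (hε x hx.2) hεy v (fun a i => (hk i).2 a) (fun i => (hk i).1)
  refine ⟨⟨hJs, hpull⟩, fun J' hJ' x hx => ?_⟩
  -- On this family i_X μ is nonzero, and its vectors are tangent to the impact surface, so the
  -- pullback identity determines J.
  obtain ⟨v, hv1, hv2, hv3⟩ := IsFormQuotient.exists_interior_ne_zero (V := E × (E →L[ℝ] ℝ))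
    finrank_model (liouville_ne_zero x) (c.theta_dual x) (hXf x hx.2) (hne x hx) (hε x hx.2)
  have hs := c.surjective_dLevel (hXf x hx.2) (hne x hx)
  have hvt : ∀ i, v i ∈ tangentDirections (modelT E) (s.Sstar ∩ c.zeroSet) x := fun i =>
    c.mem_tangentDirections_of_dLevel_eq_zero hx hs
      (c.dLevel_eq_zero_iff.2 ⟨hv2 i, fun a => hv1 a i⟩)
  exact mul_right_cancel₀ hv3 ((hJ'.pullback x hx v hvt).symm.trans (hpull x hx v hvt))

end InvariantConstraints

end NHImpact
end

/-! ### The global and the nonholonomic system. -/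

noncomputable section

namespace NHImpact

lemma isFormQuotient_self {V : Type*} [AddCommGroup V] [Module ℝ V] {N : ℕ}
    (θ : Fin 0 → V →ₗ[ℝ] ℝ) (μ : V [⋀^Fin N]→ₗ[ℝ] ℝ) : IsFormQuotient (zero_add N) θ μ μ := by
  intro D w _ _
  refine congrArg μ (funext fun i => ?_)
  simp [Fin.append_left_nil D w rfl]

variable {E : Type*} [NormedAddCommGroup E] [NormedSpace ℝ E] [FiniteDimensional ℝ E]
variable {Q : Type*} [TopologicalSpace Q] [ChartedSpace E Q] [IsManifold 𝓘(ℝ, E) ∞ Q]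
variable {m : ℕ}

namespace InvariantConstraints

/-- The empty family of constraints. -/
def empty (s : ImpactSystem E Q m) : InvariantConstraints s 0 where
  f a := a.elim0
  smooth a := a.elim0
  invariant a := a.elim0
  dual _ b := b.elim0
  dT_dual _ a := a.elim0
  dual_fst _ b := b.elim0

/-- The constraints `P(Wᵃ) = 0` which define `𝒟^*`. -/
def nonholonomic (s : ImpactSystem E Q m) : InvariantConstraints s m where
  f a := momentum (s.W a)
  smooth a := ImpactSystem.contMDiff_momentum (s.contMDiff_W a)
  invariant a x := s.momentum_W_impactC x a
  dual := s.dualVertical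
  dT_dual := s.dT_dualVertical
  dual_fst _ _ := rfl

omit [FiniteDimensional ℝ E] in
lemma zeroSet_empty (s : ImpactSystem E Q m) : (empty s).zeroSet = Set.univ :=
  Set.eq_univ_of_forall fun _ a => a.elim0

lemma zeroSet_nonholonomic (s : ImpactSystem E Q m) : (nonholonomic s).zeroSet = s.Dstar :=
  Set.ext fun _ => s.mem_Dstar_iff.symm

end InvariantConstraints

namespace ImpactSystem

variable (s : ImpactSystem E Q m)

lemma dhField_ne_zero {x : CotangentBundle (E := E) Q} (hx : x ∈ s.Sstar) : s.dhField x ≠ 0 := by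
  rw [dhField_eq]
  exact hx.2.ne

lemma contMDiffOn_globalJacobian : ContMDiffOn (modelT E) 𝓘(ℝ, ℝ) ∞
    (fun x => (2 * s.dhProjField x - s.dhField x) / s.dhField x) s.Sstar := by
  have h1 : ContMDiff (modelT E) 𝓘(ℝ, ℝ) ∞ s.dhField := by
    rw [funext s.dhField_eq]
    exact contMDiff_momentum s.contMDiff_gradh
  have h2 : ContMDiff (modelT E) 𝓘(ℝ, ℝ) ∞ s.dhProjField := by
    rw [funext s.dhProjField_eq]
    exact contMDiff_momentum s.contMDiff_gradhD
  exact (((contMDiff_const.mul h2).sub h1).contMDiffOn).div₀ h1.contMDiffOn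
    fun x hx => s.dhField_ne_zero hx

lemma globalJacobian_mul {x : CotangentBundle (E := E) Q} (hx : x ∈ s.Sstar) :
    (2 * s.dhProjField x - s.dhField x) / s.dhField x * momentum s.gradh x =
      - momentum s.gradh (s.impactC x) := by
  have h := s.dhField_ne_zero hx
  rw [s.momentum_gradh_impactC hx.1, ← dhField_eq, ← dhProjField_eq, div_mul_cancel₀ _ h]
  ring

theorem global_hybridJacobian :
    IsHybridJacobian (modelT E) s.Sstar s.nhField s.impactC liouville
        (fun x => (2 * s.dhProjField x - s.dhField x) / s.dhField x) ∧
      ∀ J, IsHybridJacobian (modelT E) s.Sstar s.nhField s.impactC liouville J →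
        ∀ x ∈ s.Sstar, J x = (2 * s.dhProjField x - s.dhField x) / s.dhField x := by
  have hS : s.Sstar ∩ (InvariantConstraints.empty s).zeroSet = s.Sstar := by
    rw [InvariantConstraints.zeroSet_empty, Set.inter_univ]
  have h := (InvariantConstraints.empty s).isHybridJacobian_and_unique
    (zero_add (2 * Module.finrank ℝ E)) (X := s.nhField) (ε := liouville) (Δ := s.impactC)
    (J := fun x => (2 * s.dhProjField x - s.dhField x) / s.dhField x)
    (fun x _ => s.nhField_fst x) (fun _ _ a => a.elim0)
    (fun x _ => isFormQuotient_self _ _) (fun _ _ => rfl)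
    (by rw [hS]; exact s.contMDiffOn_globalJacobian) (fun x hx => s.globalJacobian_mul hx.1)
  rwa [hS] at h

/-- The differentials of P(W¹), …, P(Wᵐ) are independent at `x`, so m ≤ 2n and the natural-number
subtraction is exact. -/
lemma codim_add_dim (s : ImpactSystem E Q m) (x : CotangentBundle (E := E) Q) :
    m + (2 * Module.finrank ℝ E - m) = 2 * Module.finrank ℝ E := by
  have h := finrank_commonKer _ _ ((InvariantConstraints.nonholonomic s).theta_dual x)
  rw [finrank_model] at h
  omega

/-- The quotient form may be chosen point by point, as `RepresentsNHVolume` asks for no regularity.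
-/
lemma exists_representsNHVolume : ∃ ε, s.RepresentsNHVolume ε := by
  have h : ∀ x : CotangentBundle (E := E) Q, ∃ ε : (TangentSpace (modelT E) x)
      [⋀^Fin (2 * Module.finrank ℝ E - m)]→ₗ[ℝ] ℝ,
        (wedge (s.sigma x) ε).domDomCongr (finCongr (s.codim_add_dim x)) = liouville x :=
    fun x => exists_wedge_eq (V := E × (E →L[ℝ] ℝ)) (s.codim_add_dim x) finrank_model _ _
      ((InvariantConstraints.nonholonomic s).theta_dual x) (liouville x)
  choose ε hε using h
  exact ⟨ε, fun x _ => ⟨_, hε x⟩⟩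

variable {s}

omit [FiniteDimensional ℝ E] in
lemma RepresentsNHVolume.isFormQuotient
    {ε : ∀ x : CotangentBundle (E := E) Q,
      (TangentSpace (modelT E) x) [⋀^Fin (2 * Module.finrank ℝ E - m)]→ₗ[ℝ] ℝ}
    (hε : s.RepresentsNHVolume ε) {x : CotangentBundle (E := E) Q} (hx : x ∈ s.Dstar)
    (e : m + (2 * Module.finrank ℝ E - m) = 2 * Module.finrank ℝ E) :
    IsFormQuotient e (fun a => dT (momentum (s.W a)) x) (liouville x) (ε x) :=
  isFormQuotient_of_wedge_eq e _ _ _ (hε x hx).choose_spec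

lemma RepresentsNHVolume.eq_on_tangentDirections
    {ε ε' : ∀ x : CotangentBundle (E := E) Q,
      (TangentSpace (modelT E) x) [⋀^Fin (2 * Module.finrank ℝ E - m)]→ₗ[ℝ] ℝ}
    (hε : s.RepresentsNHVolume ε) (hε' : s.RepresentsNHVolume ε')
    {x : CotangentBundle (E := E) Q} (hx : x ∈ s.Dstar)
    {v : Fin (2 * Module.finrank ℝ E - m) → TangentSpace (modelT E) x}
    (hv : ∀ i, v i ∈ tangentDirections (modelT E) s.Dstar x) : ε x v = ε' x v := by
  have e := s.codim_add_dim x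
  refine IsFormQuotient.eq_on (D := s.dualVertical x) (s.dT_dualVertical x)
    (hε.isFormQuotient hx e) (hε'.isFormQuotient hx e) fun a i => ?_
  exact mfderiv_eq_zero_of_mem_tangentDirections (I := modelT E) hx
    ((contMDiff_momentum (s.contMDiff_W a) x).mdifferentiableAt (by simp)) (c := 0)
    (fun y hy => s.mem_Dstar_iff.1 hy a) (hv i)

theorem nonholonomic_hybridJacobian
    {X : ∀ x : CotangentBundle (E := E) Q, TangentSpace (modelT E) x}
    {ε : ∀ x : CotangentBundle (E := E) Q,
      (TangentSpace (modelT E) x) [⋀^Fin (2 * Module.finrank ℝ E - m)]→ₗ[ℝ] ℝ}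
    (hX : s.IsNonholonomicField X) (hε : s.RepresentsNHVolume ε) :
    IsHybridJacobian (modelT E) s.SstarD X s.impactD ε (fun _ => 1) ∧
      ∀ J, IsHybridJacobian (modelT E) s.SstarD X s.impactD ε J → ∀ x ∈ s.SstarD, J x = 1 := by
  -- The inequality m ≤ 2n is deduced at a point, so an empty cotangent bundle is treated apart.
  rcases isEmpty_or_nonempty (CotangentBundle (E := E) Q) with h | ⟨⟨x₀⟩⟩
  · exact ⟨⟨contMDiffOn_const, fun x => isEmptyElim x⟩, fun _ _ x => isEmptyElim x⟩
  have e := s.codim_add_dim x₀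
  have hN := InvariantConstraints.zeroSet_nonholonomic s
  have hS : s.Sstar ∩ (InvariantConstraints.nonholonomic s).zeroSet = s.SstarD := by
    rw [hN]
    rfl
  have h := (InvariantConstraints.nonholonomic s).isHybridJacobian_and_unique e (X := X) (ε := ε)
    (Δ := s.impactD) (J := fun _ => 1)
    (fun x hx => IsNonholonomicField.fst_eq s hX (hN ▸ hx)) (fun x hx => (hX x (hN ▸ hx)).1)
    (fun x hx => hε.isFormQuotient (hN ▸ hx) e) (fun x hx => s.impactD_eq_impactC (hN ▸ hx.2))
    contMDiffOn_const (fun x hx => by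
      rw [s.momentum_gradh_impactC hx.1.1, s.momentum_gradhD_of_mem_Dstar (hN ▸ hx.2)]
      ring)
  rwa [hS] at h

variable (s)

lemma contMDiffOn_impactC : ContMDiffOn (modelT E) (modelT E) ∞ s.impactC s.Sstar :=
  fun _ hx => (s.contMDiffAt_impactC hx.1).contMDiffWithinAt

lemma contMDiffOn_impactD : ContMDiffOn (modelT E) (modelT E) ∞ s.impactD s.SstarD :=
  (s.contMDiffOn_impactC.mono Set.inter_subset_left).congr fun _ hx => s.impactD_eq_impactC hx.2

lemma mapsTo_impactD : Set.MapsTo s.impactD s.SstarD s.Dstar := by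
  intro x hx
  rw [s.impactD_eq_impactC hx.2, mem_Dstar_iff]
  exact fun a => (s.momentum_W_impactC x a).trans (s.mem_Dstar_iff.1 hx.2 a)

end ImpactSystem

end NHImpact
end

theorem mainTheorem3 {E : Type*} [NormedAddCommGroup E] [NormedSpace ℝ E] [FiniteDimensional ℝ E]
    {Q : Type*} [TopologicalSpace Q] [ChartedSpace E Q] [IsManifold 𝓘(ℝ, E) ∞ Q]
    {m : ℕ} (s : NHImpact.ImpactSystem E Q m) :
    -- the global system `(T^*Q, S^*, Ξ_H^𝒞, Δ^𝒞)` and the volume form `ωⁿ`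
    (ContMDiffOn (NHImpact.modelT E) (NHImpact.modelT E) ∞ s.impactC s.Sstar ∧
      (∀ x ∈ s.Sstar, s.dhField x ≠ 0) ∧
      NHImpact.IsHybridJacobian (NHImpact.modelT E) s.Sstar s.nhField s.impactC
        NHImpact.ImpactSystem.liouville
        (fun x => (2 * s.dhProjField x - s.dhField x) / s.dhField x) ∧
      ∀ J : NHImpact.CotangentBundle (E := E) Q → ℝ,
        NHImpact.IsHybridJacobian (NHImpact.modelT E) s.Sstar s.nhField s.impactC
          NHImpact.ImpactSystem.liouville J →
        ∀ x ∈ s.Sstar, J x = (2 * s.dhProjField x - s.dhField x) / s.dhField x) ∧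
    -- the restricted system `(𝒟^*, S^*_𝒟, X_H^𝒟, Δ^𝒟)` and the volume form `μ_𝒞`
    (ContMDiffOn (NHImpact.modelT E) (NHImpact.modelT E) ∞ s.impactD s.SstarD ∧
      Set.MapsTo s.impactD s.SstarD s.Dstar ∧
      s.IsNonholonomicField s.nhField ∧
      (∃ ε, s.RepresentsNHVolume ε) ∧
      (∀ ε ε', s.RepresentsNHVolume ε → s.RepresentsNHVolume ε' → ∀ x ∈ s.Dstar,
        ∀ v : Fin (2 * Module.finrank ℝ E - m) → TangentSpace (NHImpact.modelT E) x,
          (∀ i, v i ∈ NHImpact.tangentDirections (NHImpact.modelT E) s.Dstar x) →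
            ε x v = ε' x v) ∧
      ∀ X ε, s.IsNonholonomicField X → s.RepresentsNHVolume ε →
        NHImpact.IsHybridJacobian (NHImpact.modelT E) s.SstarD X s.impactD ε (fun _ => 1) ∧
        ∀ J : NHImpact.CotangentBundle (E := E) Q → ℝ,
          NHImpact.IsHybridJacobian (NHImpact.modelT E) s.SstarD X s.impactD ε J →
            ∀ x ∈ s.SstarD, J x = 1) :=
  ⟨⟨s.contMDiffOn_impactC, fun _ hx => s.dhField_ne_zero hx, s.global_hybridJacobian⟩,
    s.contMDiffOn_impactD, s.mapsTo_impactD, s.isNonholonomicField_nhField,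
    s.exists_representsNHVolume,
    fun _ _ hε hε' _ hx _ hv => hε.eq_on_tangentDirections hε' hx hv,
    fun _ _ hX hε => NHImpact.ImpactSystem.nonholonomic_hybridJacobian hX hε⟩
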